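/- Let $F$ be a field of characteristic $p\neq 2$ (with $p=0$ allowed), let $G$ be a group, and let $\sigma:G\to\{\pm1\}$ be a nontrivial homomorphism with kernel $N$. Let $(FG)^+$ be the set of elements of the group algebra $FG$ that are fixed by the involution $\left(\sum_{g}\alpha_g g\right)^*=\sum_{g}\alpha_g\sigma(g)g^{-1}$. For a subset $S$ of a ring $R$ let $S^{(1)}=R$ and, for $i\geq 2$, let $S^{(i)}$ be the two-sided ideal of $R$ generated by all $[a,b]=ab-ba$ with $a\in S^{(i-1)}$ and $b\in S$; $S$ is called strongly Lie nilpotent if $S^{(i)}=0$ for some $i\ge 1$. Let $x,y\in G$ be such that $\langle x,y\rangle\simeq Q_8$, the quaternion group of order $8$. Then $(FG)^+$ is strongly Lie nilpotent if and only if one of the following holds: (i) $p=0$, and there are a group $E$ with $e^2=1$ for all $e\in E$ and an element $g\in G\setminus N$ such that $N\simeq Q_8\times E$, $G\simeq\langle x,y,g\rangle\times E$, $gx=xg$, $gy=yg$ and $g^2=x^2$; (ii) $p>2$, and there are a group $E$ with $e^2=1$ for all $e\in E$, a finite $p$-group $P$ and an element $g\in G\setminus N$ such that $N\simeq Q_8\times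 E\times P$, $G\simeq\langle x,y,g\rangle\times E\times P$, $gx=xg$, $gy=yg$ and $g^2=x^2$. Moreover, $((FG)^+)^{(2)}=0$ in case (i), and $((FG)^+)^{(2|P|)}=0$ in case (ii). -/

import Mathlib

universe u

/-- The classical involution of the group algebra `F[G]` oriented by a homomorphism
`σ : G → {1, -1}`: it sends `∑ α_g g` to `∑ α_g σ(g) g⁻¹`. -/
noncomputable def orientedInvolution {F G : Type*} [Field F] [Group G] (σ : G →* ℤˣ)
    (α : MonoidAlgebra F G) : MonoidAlgebra F G :=
  ∑ g ∈ α.coeff.support, MonoidAlgebra.single g⁻¹ (α.coeff g * (((σ g : ℤˣ) : ℤ) : F))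

/-- The set `(FG)⁺` of elements fixed by the oriented involution. -/
def symmetricElements (F : Type*) {G : Type*} [Field F] [Group G] (σ : G →* ℤˣ) :
    Set (MonoidAlgebra F G) :=
  {α | orientedInvolution σ α = α}

/-- The ideals `S⁽ⁱ⁾` of a ring `R`, for a subset `S` of `R`: `S⁽¹⁾ = R`, and `S⁽ⁱ⁺¹⁾` is the
two-sided ideal generated by all `[a, b] = a * b - b * a` with `a ∈ S⁽ⁱ⁾` and `b ∈ S`.
The index `0` does not occur in the mathematics; it gets the value `R` as well. -/
def upperLiePower {R : Type*} [Ring R] (S : Set R) : ℕ → TwoSidedIdeal R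
  | 0 => ⊤
  | 1 => ⊤
  | i + 2 => TwoSidedIdeal.span {c : R | ∃ a ∈ upperLiePower S (i + 1), ∃ b ∈ S, c = a * b - b * a}

/-- `S` is strongly Lie nilpotent if `S⁽ⁱ⁾ = 0` for some `i ≥ 1`. -/
def IsStronglyLieNilpotent {R : Type*} [Ring R] (S : Set R) : Prop :=
  ∃ i : ℕ, 1 ≤ i ∧ upperLiePower S i = ⊥

/-- With `N = ker σ`: `E² = 1`, `N ≃ Q₈ × E`, and there is `g ∈ G \ N` commuting with `x` and `y`
such that `g² = x²` and `G ≃ ⟨x, y, g⟩ × E`. -/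
def HasQuaternionSplitting {G : Type*} [Group G] (σ : G →* ℤˣ) (x y : G)
    (E : Type*) [Group E] : Prop :=
  (∀ e : E, e ^ 2 = 1) ∧
  Nonempty (σ.ker ≃* QuaternionGroup 2 × E) ∧
  ∃ g : G, g ∉ σ.ker ∧ Commute g x ∧ Commute g y ∧ g ^ 2 = x ^ 2 ∧
    Nonempty (G ≃* Subgroup.closure {x, y, g} × E)

/-- With `N = ker σ`: `E² = 1`, `P` is a finite `p`-group, `N ≃ Q₈ × E × P`, and there is
`g ∈ G \ N` commuting with `x` and `y` such that `g² = x²` and `G ≃ ⟨x, y, g⟩ × E × P`. -/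
def HasQuaternionPSplitting (p : ℕ) {G : Type*} [Group G] (σ : G →* ℤˣ) (x y : G)
    (E P : Type*) [Group E] [Group P] : Prop :=
  (∀ e : E, e ^ 2 = 1) ∧
  Finite P ∧ IsPGroup p P ∧
  Nonempty (σ.ker ≃* QuaternionGroup 2 × E × P) ∧
  ∃ g : G, g ∉ σ.ker ∧ Commute g x ∧ Commute g y ∧ g ^ 2 = x ^ 2 ∧
    Nonempty (G ≃* Subgroup.closure {x, y, g} × E × P)

/-!
The symmetric elements are spanned by the elements `s_g = g + σ(g) g⁻¹` (`symGen`), and `z = x ^ 2`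
denotes the central involution of `⟨x, y⟩`.

**Sufficiency.** Suppose `G ≃ ⟨x, y, g⟩ × E × P` (with `P` trivial in characteristic zero). In the
factor `A = ⟨x, y, g⟩ × E` all squares and commutators lie in `{1, z}`, the element `g` is central,
and an involution of the kernel of `σ` is central because of the shape of that kernel. Going through
the four possibilities for `σ(a)` and `a ^ 2`, one finds that `s_a` is central for every `a ∈ A`
(`symGen_mem_center`). So each symmetric element is central modulo the ideal `Δ` generated by the
`h - 1` with `h ∈ P`, whence the `(i + 1)`-st upper Lie power lies in `Δ ^ i`
(`upperLiePower_subset_pow`). Finally `Δ ^ |P| = 0` for a finite `p`-group in characteristic `p`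
(`relativeAugmentation_pow_card_eq_bot`), and `|P| + 1 ≤ 2 |P|`.

**Necessity in characteristic `p > 2`.** If the `n`-th upper Lie power vanishes and `q ≥ n` is a
power of `p`, then `s ^ q` is central for each symmetric `s`, because the `q`-th power of the
commutator with `s` is the commutator with `s ^ q`. For `s = s_g` this reads: if `σ(g) = 1` then
every conjugate of `g ^ q` is `g ^ q` or its inverse, and if `σ(g) = -1` then `g ^ q` is central or
`g ^ (2 q) = 1`.
With `q ≡ 1` modulo four, this puts `x` and `y` into the kernel, shows that `G` is the product of
`⟨x, y⟩` and its centralizer, produces the central element `g` as a `q`-th power, and makes `m ^ q` a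
central element of order at most two for every `m` in the centralizer of `x` and `y` in the kernel.
The factor `P` is the subgroup generated by the squares of these `m`. Commutation with `s_{mx}` shows
that multiplication by `h - 1`, `h ∈ P`, takes suitable elements of each upper Lie power into the
next one (`IsQuaternionOdd.mul_sub_one_mem`), so that these multiplications are nilpotent on
`1 - z`. This yields `h ^ q = 1`, and also a nonzero element of the group algebra that is fixed by
`P`; since its support is finite, so is `P`. The splitting follows
(`exists_splitting_of_pow_conditions`).

**Necessity in characteristic zero.** The vanishing of an upper Lie power is a family of identities in
the integral group ring (`lieMonomials`), so it passes to characteristics three and five. Comparing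
the two splittings of the kernel shows that `P` is trivial.
-/

open MonoidAlgebra (single of)

/-! ### Upper Lie powers and the span of the symmetric elements -/

section LiePowers

variable {R : Type*} [Ring R] {S : Set R}

theorem mem_upperLiePower_one (a : R) : a ∈ upperLiePower S 1 :=
  trivial

theorem commutator_mem_upperLiePower {i : ℕ} {a s : R} (ha : a ∈ upperLiePower S (i + 1))
    (hs : s ∈ S) : a * s - s * a ∈ upperLiePower S (i + 2) :=
  TwoSidedIdeal.subset_span ⟨a, ha, s, hs, rfl⟩

theorem upperLiePower_succ_le (S : Set R) (i : ℕ) :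
    upperLiePower S (i + 1) ≤ upperLiePower S i := by
  match i with
  | 0 => exact le_rfl
  | 1 => exact le_top
  | i + 2 =>
    refine TwoSidedIdeal.span_le.2 ?_
    rintro _ ⟨a, ha, s, hs, rfl⟩
    exact commutator_mem_upperLiePower (upperLiePower_succ_le S (i + 1) ha) hs

theorem upperLiePower_antitone (S : Set R) : Antitone (upperLiePower S) :=
  antitone_nat_of_succ_le (upperLiePower_succ_le S)

/-- If every element of `S` is a central element plus an element of the two-sided ideal `I`, then
each commutation with `S` gains a factor from `I`. -/
theorem upperLiePower_subset_pow (I : Ideal R) [I.IsTwoSided]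
    (h : ∀ s ∈ S, ∃ c ∈ Set.center R, s - c ∈ I) (i : ℕ) :
    ∀ a ∈ upperLiePower S (i + 1), a ∈ I ^ i := by
  induction i with
  | zero => simp [Submodule.pow_zero, Ideal.one_eq_top]
  | succ i ih =>
    suffices upperLiePower S (i + 2) ≤ (I ^ (i + 1)).toTwoSided from
      fun a ha ↦ Ideal.mem_toTwoSided.1 (this ha)
    refine TwoSidedIdeal.span_le.2 ?_
    rintro _ ⟨a, ha, s, hs, rfl⟩
    obtain ⟨c, hc, hd⟩ := h s hs
    have e : a * s - s * a = a * (s - c) - (s - c) * a := by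
      rw [mul_sub, sub_mul, (Set.mem_center_iff.1 hc).comm a]; abel
    rw [SetLike.mem_coe, Ideal.mem_toTwoSided, e]
    refine sub_mem ?_ ?_
    · rw [Submodule.pow_succ]
      exact Ideal.mul_mem_mul (ih a ha) hd
    · rw [Ideal.IsTwoSided.pow_succ]
      exact Ideal.mul_mem_mul hd (ih a ha)

end LiePowers

section Symmetric

variable {G : Type*} [Group G]

/-- The element `g + σ(g) g⁻¹` of the group ring; over a field of characteristic not two these
elements span the symmetric elements. -/
noncomputable def symGen (R : Type*) [CommRing R] (σ : G →* ℤˣ) (g : G) : MonoidAlgebra R G :=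
  single g 1 + single g⁻¹ (((σ g : ℤˣ) : ℤ) : R)

theorem symGen_of_eq_one (R : Type*) [CommRing R] {σ : G →* ℤˣ} {g : G} (h : σ g = 1) :
    symGen R σ g = of R G g + of R G g⁻¹ := by
  simp [symGen, h]

theorem symGen_of_eq_neg_one (R : Type*) [CommRing R] {σ : G →* ℤˣ} {g : G} (h : σ g = -1) :
    symGen R σ g = of R G g - of R G g⁻¹ := by
  simp [symGen, h, sub_eq_add_neg, MonoidAlgebra.single_neg]

variable {F : Type*} [Field F] (σ : G →* ℤˣ)

theorem orientedInvolution_single (g : G) (r : F) :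
    orientedInvolution σ (single g r) = single g⁻¹ (r * (((σ g : ℤˣ) : ℤ) : F)) := by
  change (single g r).coeff.sum
    (fun g a ↦ single g⁻¹ (a * (((σ g : ℤˣ) : ℤ) : F))) = _
  simp

theorem orientedInvolution_add (a b : MonoidAlgebra F G) :
    orientedInvolution σ (a + b) = orientedInvolution σ a + orientedInvolution σ b := by
  change (a + b).coeff.sum (fun g a ↦ single g⁻¹ (a * (((σ g : ℤˣ) : ℤ) : F))) =
    a.coeff.sum (fun g a ↦ single g⁻¹ (a * (((σ g : ℤˣ) : ℤ) : F))) +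
    b.coeff.sum (fun g a ↦ single g⁻¹ (a * (((σ g : ℤˣ) : ℤ) : F)))
  rw [MonoidAlgebra.coeff_add, Finsupp.sum_add_index'] <;> simp [add_mul]

theorem symGen_mem (g : G) : symGen F σ g ∈ symmetricElements F σ := by
  change orientedInvolution σ (symGen F σ g) = symGen F σ g
  rw [symGen, orientedInvolution_add, orientedInvolution_single, orientedInvolution_single]
  rcases Int.units_eq_one_or (σ g) with h | h <;> simp [h, add_comm]

theorem symmetricElements_subset_span (h2 : (2 : F) ≠ 0) :
    symmetricElements F σ ⊆ Submodule.span F (Set.range (symGen F σ)) := by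
  have key (a : MonoidAlgebra F G) :
      a + orientedInvolution σ a ∈ Submodule.span F (Set.range (symGen F σ)) := by
    induction a using MonoidAlgebra.induction_linear with
    | zero => simp [orientedInvolution]
    | add a b ha hb =>
      rw [orientedInvolution_add, add_add_add_comm]
      exact add_mem ha hb
    | single g r =>
      rw [orientedInvolution_single]
      have : single g r + single g⁻¹ (r * (((σ g : ℤˣ) : ℤ) : F)) = r • symGen F σ g := by
        simp [symGen]
      rw [this]
      exact Submodule.smul_mem _ _ (Submodule.subset_span ⟨g, rfl⟩)
  intro a ha
  have h := key a
  rw [show orientedInvolution σ a = a from ha, ← two_smul F] at h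
  exact (Submodule.smul_mem_iff _ h2).1 h

/-- Iterated commutators, over an arbitrary coefficient ring, whose span is the ideal
`upperLiePower (symmetricElements F σ) (i + 1)` when the coefficients form a field of
characteristic not two. All their coefficients are integers, so whether they vanish depends on the
characteristic only. -/
def lieMonomials (R : Type*) [CommRing R] (σ : G →* ℤˣ) : ℕ → Set (MonoidAlgebra R G)
  | 0 => Set.range (of R G)
  | i + 1 => {c | ∃ b ∈ lieMonomials R σ i, ∃ u g v : G,
      c = of R G u * (b * symGen R σ g - symGen R σ g * b) * of R G v}

theorem lieMonomials_subset (i : ℕ) :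
    ∀ b ∈ lieMonomials F σ i, b ∈ upperLiePower (symmetricElements F σ) (i + 1) := by
  induction i with
  | zero => exact fun b _ ↦ mem_upperLiePower_one b
  | succ i ih =>
    rintro _ ⟨b, hb, u, g, v, rfl⟩
    exact TwoSidedIdeal.mul_mem_right _ _ _ (TwoSidedIdeal.mul_mem_left _ _ _
      (commutator_mem_upperLiePower (ih b hb) (symGen_mem σ g)))

theorem of_mul_mem_lieMonomials {R : Type*} [CommRing R] (i : ℕ) (u v : G) :
    ∀ b ∈ lieMonomials R σ i, of R G u * b * of R G v ∈ lieMonomials R σ i := by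
  cases i with
  | zero =>
    rintro _ ⟨g, rfl⟩
    exact ⟨u * g * v, by simp only [map_mul]⟩
  | succ i =>
    rintro _ ⟨b, hb, u', g, v', rfl⟩
    exact ⟨b, hb, u * u', g, v' * v, by simp only [map_mul, mul_assoc]⟩

theorem mul_mem_span_lieMonomials {i : ℕ} {b : MonoidAlgebra F G}
    (hb : b ∈ Submodule.span F (lieMonomials F σ i)) (a c : MonoidAlgebra F G) :
    a * b * c ∈ Submodule.span F (lieMonomials F σ i) := by
  have hl (a : MonoidAlgebra F G) {b : MonoidAlgebra F G}
      (hb : b ∈ Submodule.span F (lieMonomials F σ i)) :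
      a * b ∈ Submodule.span F (lieMonomials F σ i) := by
    induction a using MonoidAlgebra.induction_on with
    | of g =>
      refine (Submodule.span_le (p := (Submodule.span F (lieMonomials F σ i)).comap
        (LinearMap.mulLeft F (of F G g)))).2 ?_ hb
      intro b hb
      have := of_mul_mem_lieMonomials σ i g 1 b hb
      rw [map_one, mul_one] at this
      exact Submodule.subset_span this
    | add a a' h h' => rw [add_mul]; exact add_mem h h'
    | smul r a h => rw [smul_mul_assoc]; exact Submodule.smul_mem _ _ h
  have hr (a : MonoidAlgebra F G) {b : MonoidAlgebra F G}
      (hb : b ∈ Submodule.span F (lieMonomials F σ i)) :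
      b * a ∈ Submodule.span F (lieMonomials F σ i) := by
    induction a using MonoidAlgebra.induction_on with
    | of g =>
      refine (Submodule.span_le (p := (Submodule.span F (lieMonomials F σ i)).comap
        (LinearMap.mulRight F (of F G g)))).2 ?_ hb
      intro b hb
      have := of_mul_mem_lieMonomials σ i 1 g b hb
      rw [map_one, one_mul] at this
      exact Submodule.subset_span this
    | add a a' h h' => rw [mul_add]; exact add_mem h h'
    | smul r a h => rw [mul_smul_comm]; exact Submodule.smul_mem _ _ h
  exact hr c (hl a hb)

theorem upperLiePower_subset_span (h2 : (2 : F) ≠ 0) (i : ℕ) :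
    ∀ a ∈ upperLiePower (symmetricElements F σ) (i + 1),
      a ∈ Submodule.span F (lieMonomials F σ i) := by
  induction i with
  | zero =>
    intro a _
    induction a using MonoidAlgebra.induction_on with
    | of g => exact Submodule.subset_span ⟨g, rfl⟩
    | add a a' h h' => exact add_mem (h trivial) (h' trivial)
    | smul r a h => exact Submodule.smul_mem _ _ (h trivial)
  | succ i ih =>
    have comm {a s : MonoidAlgebra F G} (ha : a ∈ Submodule.span F (lieMonomials F σ i))
        (hs : s ∈ Submodule.span F (Set.range (symGen F σ))) :
        a * s - s * a ∈ Submodule.span F (lieMonomials F σ (i + 1)) := by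
      induction ha, hs using Submodule.span_induction₂ with
      | mem_mem b s hb hs =>
        obtain ⟨g, rfl⟩ := hs
        exact Submodule.subset_span ⟨b, hb, 1, g, 1, by simp only [map_one, one_mul, mul_one]⟩
      | zero_left => simp
      | zero_right => simp
      | add_left a b s _ _ _ h h' =>
        convert add_mem h h' using 1; noncomm_ring
      | add_right a s t _ _ _ h h' =>
        convert add_mem h h' using 1; noncomm_ring
      | smul_left r a s _ _ h =>
        rw [smul_mul_assoc, mul_smul_comm, ← smul_sub]; exact Submodule.smul_mem _ _ h
      | smul_right r a s _ _ h =>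
        rw [smul_mul_assoc, mul_smul_comm, ← smul_sub]; exact Submodule.smul_mem _ _ h
    intro c hc
    induction hc using TwoSidedIdeal.span_induction with
    | mem c hc =>
      obtain ⟨a, ha, s, hs, rfl⟩ := hc
      exact comm (ih a ha) (symmetricElements_subset_span σ h2 hs)
    | zero => exact zero_mem _
    | add a b _ _ ha hb => exact add_mem ha hb
    | neg a _ ha => exact neg_mem ha
    | left_absorb a b _ h => simpa using mul_mem_span_lieMonomials σ h a 1
    | right_absorb a b _ h => simpa using mul_mem_span_lieMonomials σ h 1 a

theorem map_mem_lieMonomials {R R' : Type*} [CommRing R] [CommRing R'] (f : R →+* R') (i : ℕ) :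
    ∀ b ∈ lieMonomials R σ i, MonoidAlgebra.mapRingHom G f b ∈ lieMonomials R' σ i := by
  have hs (g : G) : MonoidAlgebra.mapRingHom G f (symGen R σ g) = symGen R' σ g := by
    simp [symGen]
  induction i with
  | zero => rintro _ ⟨g, rfl⟩; exact ⟨g, by simp⟩
  | succ i ih =>
    rintro _ ⟨b, hb, u, g, v, rfl⟩
    refine ⟨_, ih b hb, u, g, v, ?_⟩
    simp only [map_mul, map_sub, hs]
    simp

theorem exists_int_lieMonomials {R : Type*} [CommRing R] (i : ℕ) :
    ∀ b ∈ lieMonomials R σ i, ∃ a ∈ lieMonomials ℤ σ i,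
      MonoidAlgebra.mapRingHom G (Int.castRingHom R) a = b := by
  have hs (g : G) : MonoidAlgebra.mapRingHom G (Int.castRingHom R) (symGen ℤ σ g) =
      symGen R σ g := by
    simp [symGen]
  induction i with
  | zero => rintro _ ⟨g, rfl⟩; exact ⟨_, ⟨g, rfl⟩, by simp⟩
  | succ i ih =>
    rintro _ ⟨b, hb, u, g, v, rfl⟩
    obtain ⟨a, ha, rfl⟩ := ih b hb
    refine ⟨_, ⟨a, ha, u, g, v, rfl⟩, ?_⟩
    simp only [map_mul, map_sub, hs]
    simp

/-- Strong Lie nilpotency in characteristic zero passes to every characteristic other than two,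
because the relations that express it hold in the integral group ring. -/
theorem IsStronglyLieNilpotent.of_charZero [CharZero F] {K : Type*} [Field K] (h2 : (2 : K) ≠ 0)
    (h : IsStronglyLieNilpotent (symmetricElements F σ)) :
    IsStronglyLieNilpotent (symmetricElements K σ) := by
  obtain ⟨n, hn, h⟩ := h
  obtain ⟨n, rfl⟩ : ∃ m, n = m + 1 := ⟨n - 1, by omega⟩
  refine ⟨n + 1, hn, ?_⟩
  have hz : ∀ a ∈ lieMonomials ℤ σ n, a = 0 := by
    intro a ha
    have h1 := lieMonomials_subset (F := F) σ n _ (map_mem_lieMonomials σ (Int.castRingHom F) n a ha)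
    rw [h] at h1
    have h0 : MonoidAlgebra.mapRingHom G (Int.castRingHom F) a = 0 := h1
    ext g
    have := congrArg (fun b ↦ b.coeff g) h0
    simpa using this
  rw [eq_bot_iff]
  intro a ha
  have := upperLiePower_subset_span (F := K) σ h2 n a ha
  have hle : Submodule.span K (lieMonomials K σ n) ≤ ⊥ := by
    refine Submodule.span_le.2 fun b hb ↦ ?_
    obtain ⟨c, hc, rfl⟩ := exists_int_lieMonomials σ n b hb
    simp [hz c hc]
  exact hle this

end Symmetric

/-! ### Nilpotency of the augmentation ideal of a normal `p`-subgroup -/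

section RelativeAugmentation

variable {G : Type*} [Group G]

/-- The left ideal generated by the elements `h - 1` with `h ∈ P`. If `P` is normal, it is two-sided
and it is the kernel of `F[G] → F[G ⧸ P]`. -/
noncomputable def relativeAugmentation (F : Type*) [Field F] (P : Subgroup G) :
    Ideal (MonoidAlgebra F G) :=
  Ideal.span {a | ∃ h ∈ P, a = of F G h - 1}

variable {F : Type*} [Field F]

theorem of_sub_one_mem {P : Subgroup G} {h : G} (hh : h ∈ P) :
    of F G h - 1 ∈ relativeAugmentation F P :=
  Ideal.subset_span ⟨h, hh, rfl⟩

instance (P : Subgroup G) [hP : P.Normal] : (relativeAugmentation F P).IsTwoSided where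
  mul_mem_of_left {a} b ha := by
    induction ha using Submodule.span_induction with
    | mem a ha =>
      obtain ⟨h, hh, rfl⟩ := ha
      induction b using MonoidAlgebra.induction_on with
      | of g =>
        have e : (of F G h - 1) * of F G g = of F G g * (of F G (g⁻¹ * h * g) - 1) := by
          rw [sub_mul, mul_sub, ← map_mul, ← map_mul]
          simp [mul_assoc]
        rw [e]
        exact Ideal.mul_mem_left _ _ (of_sub_one_mem (by simpa using hP.conj_mem h hh g⁻¹))
      | add b c hb hc => rw [mul_add]; exact add_mem hb hc
      | smul r b hb =>
        rw [mul_smul_comm, ← smul_one_mul]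
        exact Ideal.mul_mem_left _ _ hb
    | zero => simp
    | add a a' _ _ h h' => rw [add_mul]; exact add_mem h h'
    | smul r a _ h => rw [smul_eq_mul, mul_assoc]; exact Ideal.mul_mem_left _ _ h

theorem mem_relativeAugmentation_of_mapDomain_eq_zero (P : Subgroup G) [P.Normal]
    {a : MonoidAlgebra F G} (ha : MonoidAlgebra.mapDomainRingHom F (QuotientGroup.mk' P) a = 0) :
    a ∈ relativeAugmentation F P := by
  -- `L` sends a coset to a representative, so it is a section of `F[G] → F[G ⧸ P]`.
  let L : MonoidAlgebra F (G ⧸ P) → MonoidAlgebra F G := MonoidAlgebra.mapDomain Quotient.out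
  have key (a : MonoidAlgebra F G) :
      a - L (MonoidAlgebra.mapDomainRingHom F (QuotientGroup.mk' P) a) ∈
        relativeAugmentation F P := by
    induction a using MonoidAlgebra.induction_linear with
    | zero => simp [L]
    | add a b ha hb =>
      have e : L (MonoidAlgebra.mapDomainRingHom F (QuotientGroup.mk' P) (a + b)) =
          L (MonoidAlgebra.mapDomainRingHom F (QuotientGroup.mk' P) a) +
          L (MonoidAlgebra.mapDomainRingHom F (QuotientGroup.mk' P) b) := by
        simp only [map_add, L, MonoidAlgebra.mapDomain_add]
      rw [e, add_sub_add_comm]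
      exact add_mem ha hb
    | single g r =>
      obtain ⟨h, hh⟩ := QuotientGroup.mk_out_eq_mul P g
      have e : single g r - L (MonoidAlgebra.mapDomainRingHom F (QuotientGroup.mk' P) (single g r)) =
          -(single g r * (of F G h - 1)) := by
        have : (Quotient.out (g : G ⧸ P) : G) = g * h := hh
        simp [L, mul_sub, this]
      rw [e]
      exact neg_mem (Ideal.mul_mem_left _ _ (of_sub_one_mem h.2))
  simpa [L, ha] using key a

theorem exists_eq_mul_pow_of_mem_span_singleton_pow {R : Type*} [Ring R] {d : R}
    (hd : ∀ r, Commute d r) (n : ℕ) : ∀ a ∈ Ideal.span {d} ^ n, ∃ r, a = r * d ^ n := by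
  induction n with
  | zero => exact fun a _ ↦ ⟨a, by simp⟩
  | succ n ih =>
    intro a ha
    rw [Submodule.pow_succ] at ha
    refine Submodule.mul_induction_on ha ?_ ?_
    · intro b hb c hc
      obtain ⟨r, rfl⟩ := ih b hb
      obtain ⟨t, rfl⟩ := Ideal.mem_span_singleton'.1 hc
      refine ⟨r * t, ?_⟩
      rw [pow_succ, mul_assoc, ← mul_assoc (d ^ n), ((hd t).pow_left n).eq]
      simp only [mul_assoc]
    · rintro _ _ ⟨r, rfl⟩ ⟨t, rfl⟩
      exact ⟨r + t, by rw [add_mul]⟩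

theorem relativeAugmentation_zpowers_pow_eq_bot (p : ℕ) [Fact p.Prime] [CharP F p] {c : G}
    (hc : ∀ g, Commute c g) (hcp : c ^ p = 1) :
    relativeAugmentation F (Subgroup.zpowers c) ^ p = ⊥ := by
  have hd : ∀ r, Commute (of F G c - 1) r := by
    intro r
    refine Commute.sub_left ?_ (Commute.one_left r)
    induction r using MonoidAlgebra.induction_on with
    | of g => exact (hc g).map (of F G)
    | add a b ha hb => exact ha.add_right hb
    | smul r a ha => exact ha.smul_right r
  have hle : relativeAugmentation F (Subgroup.zpowers c) ≤ Ideal.span {of F G c - 1} := by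
    refine Ideal.span_le.2 ?_
    rintro _ ⟨h, hh, rfl⟩
    have hfin : IsOfFinOrder c :=
      isOfFinOrder_iff_pow_eq_one.2 ⟨p, (Fact.out : p.Prime).pos, hcp⟩
    obtain ⟨k, rfl⟩ := hfin.mem_powers_iff_mem_zpowers.2 hh
    change of F G (c ^ k) - 1 ∈ _
    refine Ideal.mem_span_singleton'.2 ⟨∑ i ∈ Finset.range k, of F G c ^ i, ?_⟩
    rw [geom_sum_mul, map_pow]
  have : CharP (MonoidAlgebra F G) p :=
    charP_of_injective_algebraMap (algebraMap F (MonoidAlgebra F G)).injective p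
  have : ExpChar (MonoidAlgebra F G) p := ExpChar.prime Fact.out
  rw [eq_bot_iff]
  intro a ha
  obtain ⟨r, rfl⟩ := exists_eq_mul_pow_of_mem_span_singleton_pow hd p a
    (Ideal.pow_right_mono hle p ha)
  have h0 : (of F G c - 1) ^ p = 0 := by
    rw [sub_pow_expChar_of_commute _ (Commute.one_right _), ← map_pow, hcp, one_pow, map_one,
      sub_self]
  rw [h0, mul_zero]
  exact zero_mem _

/-- Induction on the order of `P`: a central element of order `p` exists in `P`, and it is central
in `G` because `G` acts on `P` by inner automorphisms of `P`, so it can be divided out. -/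
theorem relativeAugmentation_pow_card_eq_bot (p : ℕ) [Fact p.Prime] [CharP F p] {G : Type*}
    [Group G] (P : Subgroup G) [P.Normal] [Finite P] (hP : IsPGroup p P)
    (hin : ∀ g : G, ∃ h ∈ P, ∀ k ∈ P, g * k * g⁻¹ = h * k * h⁻¹) :
    relativeAugmentation F P ^ Nat.card P = ⊥ := by
  induction hn : Nat.card P using Nat.strong_induction_on generalizing G with
  | _ n ih =>
  subst hn
  rcases subsingleton_or_nontrivial P with hs | hs
  · rw [Nat.card_of_subsingleton (1 : P), Submodule.pow_one, eq_bot_iff]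
    refine Ideal.span_le.2 ?_
    rintro _ ⟨h, hh, rfl⟩
    have : h = 1 := congrArg Subtype.val (Subsingleton.elim (⟨h, hh⟩ : P) 1)
    rw [this, map_one, sub_self]
    exact zero_mem _
  have := hP.center_nontrivial
  have hdvd : p ∣ Nat.card (Subgroup.center P) :=
    (hP.to_subgroup (Subgroup.center P)).card_eq_or_dvd.resolve_left
      Finite.one_lt_card.ne'
  obtain ⟨c, hc⟩ := exists_prime_orderOf_dvd_card' p hdvd
  obtain ⟨⟨c, hcP⟩, hcZ⟩ := c
  have hord : orderOf c = p := by
    rw [← hc, Subgroup.orderOf_mk, Subgroup.orderOf_mk]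
  have hcen : ∀ g : G, Commute c g := by
    intro g
    obtain ⟨h, hh, e⟩ := hin g
    have h1 : h * c = c * h :=
      congrArg Subtype.val (Subgroup.mem_center_iff.1 hcZ ⟨h, hh⟩)
    have h2 := e c hcP
    rw [h1, mul_inv_cancel_right, mul_inv_eq_iff_eq_mul] at h2
    exact h2.symm
  set Z := Subgroup.zpowers c with hZ
  have hZn : Z.Normal := by
    refine ⟨fun n hn g ↦ ?_⟩
    obtain ⟨k, rfl⟩ := Subgroup.mem_zpowers_iff.1 hn
    rw [← ((hcen g).zpow_left k).eq, mul_inv_cancel_right]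
    exact hn
  have hZP : Z ≤ P := by simpa [hZ] using hcP
  let π := QuotientGroup.mk' Z
  have hPn : (P.map π).Normal := Subgroup.Normal.map inferInstance π (QuotientGroup.mk'_surjective Z)
  have hcard : p * Nat.card (P.map π) = Nat.card P := by
    have := Subgroup.relIndex_mul_relIndex ⊥ Z P bot_le hZP
    rw [Subgroup.relIndex_bot_left, Subgroup.relIndex_bot_left, hZ, Nat.card_zpowers, hord] at this
    rw [← this, ← Subgroup.relIndex_ker, QuotientGroup.ker_mk']
  have hpos : 0 < Nat.card (P.map π) := by
    have : 0 < Nat.card P := Nat.card_pos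
    rw [← hcard] at this
    exact Nat.pos_of_mul_pos_left this
  have hlt : Nat.card (P.map π) < Nat.card P := by
    rw [← hcard]
    exact lt_mul_left hpos (Fact.out : p.Prime).one_lt
  have hfin : Finite (P.map π) := Nat.finite_of_card_ne_zero hpos.ne'
  have ih' := ih _ hlt (P.map π) (hP.map π) (by
    intro g
    obtain ⟨g, rfl⟩ := QuotientGroup.mk'_surjective Z g
    obtain ⟨h, hh, e⟩ := hin g
    refine ⟨π h, ⟨h, hh, rfl⟩, ?_⟩
    rintro _ ⟨k, hk, rfl⟩
    change π g * π k * (π g)⁻¹ = _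
    rw [← map_inv, ← map_inv, ← map_mul, ← map_mul, ← map_mul, ← map_mul, e k hk]) rfl
  let f := MonoidAlgebra.mapDomainRingHom F π
  have hf : ∀ a ∈ relativeAugmentation F P, f a ∈ relativeAugmentation F (P.map π) := by
    intro a ha
    induction ha using Submodule.span_induction with
    | mem a ha =>
      obtain ⟨h, hh, rfl⟩ := ha
      have : f (of F G h - 1) = of F _ (π h) - 1 := by
        rw [map_sub, map_one]
        simp [f]
      rw [this]
      exact of_sub_one_mem ⟨h, hh, rfl⟩
    | zero => simp
    | add a b _ _ ha hb => rw [map_add]; exact add_mem ha hb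
    | smul r a _ ha => rw [smul_eq_mul, map_mul]; exact Ideal.mul_mem_left _ _ ha
  have hfn (n : ℕ) : ∀ a ∈ relativeAugmentation F P ^ n,
      f a ∈ relativeAugmentation F (P.map π) ^ n := by
    induction n with
    | zero => simp [Submodule.pow_zero, Ideal.one_eq_top]
    | succ n ihn =>
      intro a ha
      rw [Submodule.pow_succ] at ha ⊢
      refine Submodule.mul_induction_on ha ?_ ?_
      · intro b hb c hc
        rw [map_mul]
        exact Ideal.mul_mem_mul (ihn b hb) (hf c hc)
      · intro b c hb hc
        rw [map_add]
        exact add_mem hb hc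
  have hle : relativeAugmentation F P ^ Nat.card (P.map π) ≤ relativeAugmentation F Z := by
    intro a ha
    have := hfn _ a ha
    rw [ih'] at this
    exact mem_relativeAugmentation_of_mapDomain_eq_zero Z this
  have hmul (m : ℕ) : relativeAugmentation F P ^ (m * Nat.card (P.map π)) ≤
      relativeAugmentation F Z ^ m := by
    induction m with
    | zero => simp [Submodule.pow_zero, Ideal.one_eq_top]
    | succ m ihm =>
      rw [add_mul, one_mul, Ideal.IsTwoSided.pow_add, Submodule.pow_succ]
      exact Ideal.mul_mono ihm hle
  have := hmul p
  rw [hcard, relativeAugmentation_zpowers_pow_eq_bot p hcen (by rw [← hord, pow_orderOf_eq_one])]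
    at this
  exact eq_bot_iff.2 this

end RelativeAugmentation

/-! ### The quaternion group -/

section Quaternion

theorem quaternion_sq (q : QuaternionGroup 2) : q * q = 1 ∨ q * q = QuaternionGroup.a 2 := by
  revert q; decide

theorem quaternion_mul_comm_or (q r : QuaternionGroup 2) :
    r * q = q * r ∨ r * q = q * r * QuaternionGroup.a 2 := by
  revert q r; decide

theorem quaternion_sq_of_not_comm (q r : QuaternionGroup 2) (h : q * r ≠ r * q) :
    q * q = QuaternionGroup.a 2 := by
  revert q r; decide

theorem quaternion_central_of_sq (q r : QuaternionGroup 2) (h : q * q = 1) : q * r = r * q := by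
  revert q r; decide

theorem quaternion_eq_of_central (q : QuaternionGroup 2) (h : ∀ r, r * q = q * r) :
    q = 1 ∨ q = QuaternionGroup.a 2 := by
  revert q; decide

/-- In the quaternion group the centralizer of a non-central element is commutative. -/
theorem quaternion_central_of_comm (q r s : QuaternionGroup 2) (hr : q * r = r * q)
    (hs : q * s = s * q) (hrs : r * s ≠ s * r) (t : QuaternionGroup 2) : q * t = t * q := by
  revert q r s t; decide

variable {G : Type*} [Group G] {x y : G}

theorem exists_quaternion_hom (hxy : Nonempty (Subgroup.closure {x, y} ≃* QuaternionGroup 2)) :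
    ∃ i : QuaternionGroup 2 →* G, Function.Injective i ∧ i.range = Subgroup.closure {x, y} := by
  obtain ⟨e⟩ := hxy
  refine ⟨(Subgroup.subtype _).comp e.symm.toMonoidHom, ?_, ?_⟩
  · exact Subtype.val_injective.comp e.symm.injective
  · rw [MonoidHom.range_comp, MonoidHom.range_eq_top.2 e.symm.surjective, ← MonoidHom.range_eq_map,
      Subgroup.range_subtype]

theorem mul_ne_of_closure_equiv_quaternion
    (hxy : Nonempty (Subgroup.closure {x, y} ≃* QuaternionGroup 2)) :
    x * y ≠ y * x := by
  intro h
  obtain ⟨e⟩ := hxy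
  have hc : IsMulCommutative (Subgroup.closure {x, y}) := by
    refine Subgroup.isMulCommutative_closure ?_
    rintro a (rfl | rfl) b (rfl | rfl) <;> simp [h]
  have : ∀ q r : QuaternionGroup 2, q * r = r * q := by
    intro q r
    apply e.symm.injective
    rw [map_mul, map_mul, mul_comm']
  exact absurd (this (.a 1) (.xa 0)) (by decide)

/-- A subgroup generated by the quaternion subgroup `⟨x, y⟩` and elements centralizing it is the
product of the two. -/
theorem exists_mul_of_mem_closure {i : QuaternionGroup 2 →* G}
    (hi : i.range = Subgroup.closure {x, y})
    {K : Subgroup G} (hKx : ∀ k ∈ K, Commute k x) (hKy : ∀ k ∈ K, Commute k y)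
    {S : Set G} (hS : ∀ s ∈ S, s = x ∨ s = y ∨ s ∈ K) {a : G} (ha : a ∈ Subgroup.closure S) :
    ∃ q, ∃ k ∈ K, a = i q * k := by
  have hK : ∀ k ∈ K, ∀ q, Commute k (i q) := by
    intro k hk q
    have hle : Subgroup.closure {x, y} ≤ Subgroup.centralizer {k} := by
      rw [Subgroup.closure_le]
      rintro b (rfl | rfl)
      · exact Subgroup.mem_centralizer_singleton_iff.2 (hKx k hk).eq.symm
      · exact Subgroup.mem_centralizer_singleton_iff.2 (hKy k hk).eq.symm
    exact (Subgroup.mem_centralizer_singleton_iff.1 (hle (hi ▸ ⟨q, rfl⟩))).symm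
  induction ha using Subgroup.closure_induction with
  | mem s hs =>
    have hmem {s : G} (h : s ∈ ({x, y} : Set G)) : ∃ q, ∃ k ∈ K, s = i q * k := by
      obtain ⟨q, rfl⟩ : s ∈ i.range := hi ▸ Subgroup.subset_closure h
      exact ⟨q, 1, one_mem K, (mul_one _).symm⟩
    rcases hS s hs with rfl | rfl | h
    · exact hmem (by simp)
    · exact hmem (by simp)
    · exact ⟨1, s, h, by simp⟩
  | one => exact ⟨1, 1, one_mem K, by simp⟩
  | mul a b _ _ ha hb =>
    obtain ⟨q, k, hk, rfl⟩ := ha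
    obtain ⟨r, l, hl, rfl⟩ := hb
    exact ⟨q * r, k * l, mul_mem hk hl, by
      rw [map_mul, mul_assoc, ← mul_assoc k, (hK k hk r).eq]; simp only [mul_assoc]⟩
  | inv a _ ha =>
    obtain ⟨q, k, hk, rfl⟩ := ha
    exact ⟨q⁻¹, k⁻¹, inv_mem hk, by
      rw [mul_inv_rev, map_inv, ((hK k hk q).inv_inv).eq]⟩

end Quaternion

/-! ### Sufficiency of the splitting -/

section Sufficiency

variable {G : Type*} [Group G]

theorem symGen_commute_of_commute (R : Type*) [CommRing R] (σ : G →* ℤˣ) {a b : G}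
    (h : Commute a b) : Commute (symGen R σ a) (of R G b) := by
  have h1 := h.map (of R G)
  have h2 := h.inv_left.map (of R G)
  rcases Int.units_eq_one_or (σ a) with hs | hs
  · rw [symGen_of_eq_one R hs]; exact h1.add_left h2
  · rw [symGen_of_eq_neg_one R hs]; exact h1.sub_left h2

theorem symGen_commute_of_conj (R : Type*) [CommRing R] {σ : G →* ℤˣ} {a b : G} (hs : σ a = 1)
    (h : b * a = a⁻¹ * b) : Commute (symGen R σ a) (of R G b) := by
  have h' : b * a⁻¹ = a * b := by
    rw [mul_inv_eq_iff_eq_mul, mul_assoc, h, mul_inv_cancel_left]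
  rw [symGen_of_eq_one R hs, commute_iff_eq, add_mul, mul_add, ← map_mul, ← map_mul, ← map_mul,
    ← map_mul, h, h', add_comm]

theorem symGen_eq_zero (R : Type*) [CommRing R] {σ : G →* ℤˣ} {a : G} (hs : σ a = -1)
    (h : a * a = 1) : symGen R σ a = 0 := by
  rw [symGen_of_eq_neg_one R hs, ← eq_inv_of_mul_eq_one_left h, sub_self]

theorem mem_center_of_commute_of (F : Type*) [Field F] {a : MonoidAlgebra F G}
    (h : ∀ g, Commute a (of F G g)) : a ∈ Set.center (MonoidAlgebra F G) := by
  rw [Semigroup.mem_center_iff]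
  intro b
  induction b using MonoidAlgebra.induction_on with
  | of g => exact (h g).eq.symm
  | add b c hb hc => rw [add_mul, mul_add, hb, hc]
  | smul r b hb => rw [smul_mul_assoc, mul_smul_comm, hb]

theorem eq_one_of_sq_eq_one_of_odd {P : Type*} [Group P] [Finite P] (hodd : Odd (Nat.card P))
    {r : P} (h : r * r = 1) : r = 1 := by
  obtain ⟨k, hk⟩ := hodd
  have h1 : r ^ Nat.card P = 1 := pow_card_eq_one'
  rwa [hk, pow_succ, pow_mul, pow_two, h, one_pow, one_mul] at h1

theorem mul_comm_of_sq_eq_one {E : Type*} [Group E] (hE : ∀ e : E, e ^ 2 = 1) (e f : E) :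
    e * f = f * e := by
  have hinv (e : E) : e⁻¹ = e := inv_eq_iff_mul_eq_one.2 (by rw [← pow_two, hE])
  rw [← hinv (e * f), mul_inv_rev, hinv, hinv]

/-- The group-theoretic heart of the sufficiency: if `G` splits as `⟨x, y, g⟩ × E × P`, then the
symmetric elements attached to the elements of `⟨x, y, g⟩ × E` are central in the group algebra. -/
theorem symGen_mem_center {F : Type*} [Field F] {σ : G →* ℤˣ} {x y : G}
    (hxy : Nonempty (Subgroup.closure {x, y} ≃* QuaternionGroup 2))
    {E P : Type*} [Group E] [Group P] [Finite P] (hE : ∀ e : E, e ^ 2 = 1)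
    (hodd : Odd (Nat.card P)) (ψ : σ.ker ≃* QuaternionGroup 2 × E × P)
    {g : G} (hg : g ∉ σ.ker) (hgx : Commute g x) (hgy : Commute g y) (hg2 : g ^ 2 = x ^ 2)
    (φ : G ≃* Subgroup.closure {x, y, g} × E × P) {a : G} (ha : (φ a).2.2 = 1) :
    symGen F σ a ∈ Set.center (MonoidAlgebra F G) := by
  have hEc : ∀ e f : E, e * f = f * e := mul_comm_of_sq_eq_one hE
  obtain ⟨i, hinj, hi⟩ := exists_quaternion_hom hxy
  have hne := mul_ne_of_closure_equiv_quaternion hxy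
  have hmi {s : G} (h : s ∈ ({x, y} : Set G)) : ∃ q, i q = s := by
    have : s ∈ i.range := hi ▸ Subgroup.subset_closure h
    exact this
  obtain ⟨qx, hqx⟩ := hmi (s := x) (by simp)
  obtain ⟨qy, hqy⟩ := hmi (s := y) (by simp)
  have hqne : qx * qy ≠ qy * qx := by
    intro h
    apply hne
    rw [← hqx, ← hqy, ← map_mul, ← map_mul, h]
  have hx2 : x * x = i (.a 2) := by
    rw [← hqx, ← map_mul, quaternion_sq_of_not_comm qx qy hqne]
  have hζ4 : (QuaternionGroup.a 2 * QuaternionGroup.a 2 : QuaternionGroup 2) = 1 := by decide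
  have hx4 : x * x * (x * x) = 1 := by rw [hx2, ← map_mul, hζ4, map_one]
  have hyx : y * x = x * y * (x * x) := by
    have := (quaternion_mul_comm_or qx qy).resolve_left fun h ↦ hqne h.symm
    rw [hx2, ← hqx, ← hqy, ← map_mul, ← map_mul, ← map_mul, this]
  rw [pow_two, pow_two] at hg2
  -- The decomposition of `⟨x, y, g⟩` as a product of a quaternion group and `⟨g⟩`.
  have hle : Subgroup.closure {x, y} ≤ Subgroup.closure {x, y, g} :=
    Subgroup.closure_mono (by intro s; simp; tauto)
  have hiH (q) : i q ∈ Subgroup.closure {x, y, g} := hle (hi ▸ ⟨q, rfl⟩)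
  let iH : QuaternionGroup 2 →* Subgroup.closure {x, y, g} := i.codRestrict _ hiH
  let gH : Subgroup.closure {x, y, g} := ⟨g, Subgroup.subset_closure (by simp)⟩
  have hgi (q) : Commute g (i q) := by
    have hle : Subgroup.closure {x, y} ≤ Subgroup.centralizer {g} := by
      rw [Subgroup.closure_le]
      rintro b (rfl | rfl)
      · exact Subgroup.mem_centralizer_singleton_iff.2 hgx.eq.symm
      · exact Subgroup.mem_centralizer_singleton_iff.2 hgy.eq.symm
    exact (Subgroup.mem_centralizer_singleton_iff.1 (hle (hi ▸ ⟨q, rfl⟩))).symm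
  have hdec (h : Subgroup.closure {x, y, g}) : ∃ q, ∃ n : ℤ, h = iH q * gH ^ n := by
    obtain ⟨q, k, hk, e⟩ := exists_mul_of_mem_closure (K := Subgroup.zpowers g) hi
      (by rintro _ ⟨n, rfl⟩; exact hgx.zpow_left n)
      (by rintro _ ⟨n, rfl⟩; exact hgy.zpow_left n)
      (by
        rintro s (rfl | rfl | rfl)
        · exact Or.inl rfl
        · exact Or.inr (Or.inl rfl)
        · exact Or.inr (Or.inr (Subgroup.mem_zpowers s))) h.2
    obtain ⟨n, rfl⟩ := hk
    exact ⟨q, n, Subtype.ext e⟩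
  have hgH (h : Subgroup.closure {x, y, g}) (n : ℤ) : Commute (gH ^ n) h := by
    obtain ⟨q, m, rfl⟩ := hdec h
    refine Commute.mul_right ?_ ((Commute.refl gH).zpow_zpow n m)
    exact Commute.zpow_left (Subtype.ext (hgi q).eq) n
  -- Every element of `G` with trivial component in `P` is `j q * c` with `c` central.
  let j : QuaternionGroup 2 →* G := φ.symm.toMonoidHom.comp ((MonoidHom.inl _ (E × P)).comp iH)
  have hj (q) : φ (j q) = (iH q, 1, 1) := φ.apply_symm_apply _
  have hA {u : G} (hu : (φ u).2.2 = 1) : ∃ q c, (∀ v, Commute c v) ∧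
      (c * c = 1 ∨ c * c = j (.a 2)) ∧ u = j q * c := by
    obtain ⟨q, n, e⟩ := hdec (φ u).1
    refine ⟨q, φ.symm (gH ^ n, (φ u).2.1, 1), ?_, ?_, ?_⟩
    · intro v
      apply φ.injective
      rw [map_mul, map_mul, φ.apply_symm_apply]
      ext1
      · exact (hgH (φ v).1 n).eq
      · ext1
        · exact hEc _ _
        · simp
    · have hgg : gH * gH = iH (.a 2) := Subtype.ext (by
        change g * g = i (.a 2)
        rw [hg2, hx2])
      have : gH ^ n * gH ^ n = 1 ∨ gH ^ n * gH ^ n = iH (.a 2) := by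
        rw [← (Commute.refl gH).mul_zpow, hgg]
        rcases Int.even_or_odd' n with ⟨m, rfl | rfl⟩
        · left
          rw [zpow_mul, ← map_zpow, show ((QuaternionGroup.a 2 : QuaternionGroup 2) ^ (2 : ℤ)) = 1
            by decide, map_one, one_zpow]
        · right
          rw [zpow_add, zpow_mul, ← map_zpow, show ((QuaternionGroup.a 2 : QuaternionGroup 2) ^
            (2 : ℤ)) = 1 by decide, map_one, one_zpow, one_mul, zpow_one]
      refine this.imp ?_ ?_
      · intro h
        apply φ.injective
        rw [map_mul, φ.apply_symm_apply, map_one]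
        ext1
        · exact h
        · ext1
          · simpa [pow_two] using hE (φ u).2.1
          · simp
      · intro h
        apply φ.injective
        rw [map_mul, φ.apply_symm_apply, hj]
        ext1
        · exact h
        · ext1
          · simpa [pow_two] using hE (φ u).2.1
          · simp
    · apply φ.injective
      rw [map_mul, φ.apply_symm_apply, hj]
      ext1
      · exact e
      · ext1
        · simp
        · simpa using hu
  have hA_of {u : G} (h : u * u * (u * u) = 1) : (φ u).2.2 = 1 := by
    have h1 : (φ u).2.2 * (φ u).2.2 * ((φ u).2.2 * (φ u).2.2) = 1 := by
      have := congrArg (fun v ↦ (φ v).2.2) h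
      simpa using this
    exact eq_one_of_sq_eq_one_of_odd hodd (eq_one_of_sq_eq_one_of_odd hodd h1)
  have hcomm_of {u v : G} {q r : QuaternionGroup 2} {c d : G} (hc : ∀ v, Commute c v)
      (hd : ∀ v, Commute d v) (hu : u = j q * c) (hv : v = j r * d) :
      u * v = j (q * r) * (c * d) ∧ v * u = j (r * q) * (c * d) := by
    subst hu hv
    constructor
    · rw [map_mul, mul_assoc, ← mul_assoc c, (hc (j r)).eq]; simp only [mul_assoc]
    · rw [map_mul, mul_assoc, ← mul_assoc d, (hd (j q)).eq, (hc d).eq]; simp only [mul_assoc]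
  have hj_inj : Function.Injective j := by
    intro q r h
    apply hinj
    have := congrArg φ h
    rw [hj, hj] at this
    exact congrArg (fun u ↦ (u.1 : G)) this
  obtain ⟨rx, cx, hcx, -, ex⟩ := hA (hA_of hx4)
  obtain ⟨ry, cy, hcy, -, ey⟩ := hA (u := y) (hA_of (by
    rw [← hqy, ← map_mul, quaternion_sq_of_not_comm qy qx (Ne.symm hqne), ← map_mul, hζ4, map_one]))
  have hrne : rx * ry ≠ ry * rx := by
    intro h
    apply hne
    rw [(hcomm_of hcx hcy ex ey).1, (hcomm_of hcx hcy ex ey).2, h]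
  -- The element `x ^ 2` is also the square of the corresponding element of the first factor.
  have hz : x * x = j (.a 2) := by
    have h1 := (hcomm_of hcx hcy ex ey).1
    have h2 := (hcomm_of hcx hcy ex ey).2
    have hcc := ((hcx (j (.a 2))).mul_left (hcy _)).eq
    rw [hyx, h1, (quaternion_mul_comm_or rx ry).resolve_left (Ne.symm hrne), map_mul _ (rx * ry),
      mul_assoc (j (rx * ry)) (j _), ← hcc, ← mul_assoc (j (rx * ry)) (cx * cy) (j _)] at h2
    exact mul_left_cancel h2
  -- The radical of the commutator pairing is the centre, so `g` is central.
  have hgc : ∀ u, Commute g u := by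
    obtain ⟨q, c, hc, -, eg⟩ := hA (hA_of (u := g) (by rw [hg2, hx4]))
    have hcan {v : G} {r d} (hd : ∀ v, Commute d v) (hv : v = j r * d) (h : Commute g v) :
        q * r = r * q := by
      have := h.eq
      rw [(hcomm_of hc hd eg hv).1, (hcomm_of hc hd eg hv).2] at this
      exact hj_inj (mul_right_cancel this)
    have hq := quaternion_central_of_comm q rx ry (hcan hcx ex hgx) (hcan hcy ey hgy) hrne
    intro u
    rw [eg]
    refine Commute.mul_left ?_ (hc u)
    apply φ.injective
    rw [map_mul, map_mul, hj]
    obtain ⟨r, n, e⟩ := hdec (φ u).1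
    ext1
    · change iH q * (φ u).1 = (φ u).1 * iH q
      rw [e]
      have h1 : Commute (iH q) (iH r) := Commute.map (hq r) iH
      exact (h1.mul_right (hgH _ n).symm).eq
    · ext1 <;> simp
  have hσg : σ g = -1 := (Int.units_eq_one_or (σ g)).resolve_left hg
  -- Involutions in the kernel of `σ` are central.
  have hinvol {n : G} (hn : σ n = 1) (h : n * n = 1) : ∀ u, Commute n u := by
    have hker (u : G) (hu : σ u = 1) : Commute n u := by
      have h1 : ψ ⟨n, hn⟩ * ψ ⟨n, hn⟩ = 1 := by
        rw [← map_mul, ← map_one ψ]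
        exact congrArg ψ (Subtype.ext h)
      have h2 : ψ ⟨n, hn⟩ * ψ ⟨u, hu⟩ = ψ ⟨u, hu⟩ * ψ ⟨n, hn⟩ := by
        ext1
        · exact quaternion_central_of_sq _ _ (congrArg Prod.fst h1)
        · ext1
          · exact hEc _ _
          · have h3 : (ψ ⟨n, hn⟩).2.2 = 1 :=
              eq_one_of_sq_eq_one_of_odd hodd (congrArg (fun w ↦ w.2.2) h1)
            simp [h3]
      rw [← map_mul, ← map_mul] at h2
      exact congrArg Subtype.val (ψ.injective h2)
    intro u
    rcases Int.units_eq_one_or (σ u) with hu | hu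
    · exact hker u hu
    · have h1 := hker (g⁻¹ * u) (by rw [map_mul, map_inv, hσg, hu]; decide)
      have h2 := ((hgc n).symm).mul_right h1
      rwa [mul_inv_cancel_left] at h2
  refine mem_center_of_commute_of F fun u ↦ ?_
  obtain ⟨q, c, hc, hc2, ea⟩ := hA ha
  have hj2 : j (.a 2) * j (.a 2) = 1 := by rw [← map_mul, hζ4, map_one]
  have ha2 : a * a = 1 ∨ a * a = j (.a 2) := by
    rw [(hcomm_of hc hc ea ea).1]
    rcases quaternion_sq q with h | h <;> rcases hc2 with h' | h' <;> simp [h, h', hj2]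
  rcases Int.units_eq_one_or (σ a) with hs | hs <;> rcases ha2 with h2 | h2
  · exact symGen_commute_of_commute F σ (hinvol hs h2 u)
  · have hainv : a⁻¹ = a * j (.a 2) := by
      rw [inv_eq_iff_mul_eq_one, ← mul_assoc, h2, hj2]
    -- Only the component of `u` in the quaternion group matters.
    have hu : u * a = a * u ∨ u * a = a * u * j (.a 2) := by
      have hv : (φ (φ.symm ((φ u).1, (φ u).2.1, 1))).2.2 = 1 := by simp
      obtain ⟨r, d, hd, -, ev⟩ := hA hv
      set v := φ.symm ((φ u).1, (φ u).2.1, 1) with hvdef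
      have hw : Commute a (φ.symm (1, 1, (φ u).2.2)) := by
        apply φ.injective
        rw [map_mul, map_mul, φ.apply_symm_apply]
        ext1
        · simp
        · ext1 <;> simp [ha]
      have huv : u = φ.symm (1, 1, (φ u).2.2) * v := by
        apply φ.injective
        rw [map_mul, hvdef, φ.apply_symm_apply, φ.apply_symm_apply]
        simp
      have hva : v * a = a * v ∨ v * a = a * v * j (.a 2) := by
        rw [(hcomm_of hc hd ea ev).1, (hcomm_of hc hd ea ev).2]
        refine (quaternion_mul_comm_or q r).imp (fun h ↦ by rw [h]) fun h ↦ ?_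
        rw [h, map_mul, mul_assoc, mul_assoc, ((hc (j (.a 2))).mul_left (hd _)).eq]
      rw [huv, mul_assoc, ← mul_assoc a, hw.eq]
      refine hva.imp (fun h ↦ by rw [h, mul_assoc]) fun h ↦ by rw [h]; simp only [mul_assoc]
    rcases hu with hu | hu
    · exact symGen_commute_of_commute F σ hu.symm
    · refine symGen_commute_of_conj F hs ?_
      have hzc : Commute (j (.a 2)) u := by
        rw [← hz, ← hg2]
        exact (hgc u).mul_left (hgc u)
      rw [hu, hainv, mul_assoc, mul_assoc, hzc.eq]
  -- Here `a = a⁻¹` and `σ a = -1`, so the symmetric element vanishes.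
  · rw [symGen_eq_zero F hs h2]
    exact Commute.zero_left _
  -- Here `g⁻¹ * a` is an involution of the kernel.
  · have hn : ∀ u, Commute (g⁻¹ * a) u := by
      refine hinvol (by rw [map_mul, map_inv, hσg, hs]; decide) ?_
      rw [mul_assoc, ← mul_assoc a, ← ((hgc a).inv_left).eq, mul_assoc, h2, ← mul_assoc,
        ← mul_inv_rev, hg2, hz, inv_mul_cancel]
    have := (hgc u).mul_left (hn u)
    rw [mul_inv_cancel_left] at this
    exact symGen_commute_of_commute F σ this

/-- Both cases of the sufficiency at once; in characteristic zero it is applied with `P` trivial. -/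
theorem upperLiePower_eq_bot_of_splitting {F : Type*} [Field F] (h2 : (2 : F) ≠ 0)
    {σ : G →* ℤˣ} {x y : G}
    (hxy : Nonempty (Subgroup.closure {x, y} ≃* QuaternionGroup 2))
    {E P : Type*} [Group E] [Group P] [Finite P] (hE : ∀ e : E, e ^ 2 = 1)
    (hodd : Odd (Nat.card P)) (ψ : σ.ker ≃* QuaternionGroup 2 × E × P)
    {g : G} (hg : g ∉ σ.ker) (hgx : Commute g x) (hgy : Commute g y) (hg2 : g ^ 2 = x ^ 2)
    (φ : G ≃* Subgroup.closure {x, y, g} × E × P)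
    (hp : Subsingleton P ∨ ∃ p : ℕ, p.Prime ∧ CharP F p ∧ IsPGroup p P) :
    upperLiePower (symmetricElements F σ) (Nat.card P + 1) = ⊥ := by
  let ρ : P →* G := φ.symm.toMonoidHom.comp ((MonoidHom.inr _ _).comp (MonoidHom.inr _ _))
  have hρ (r) : φ (ρ r) = (1, 1, r) := φ.apply_symm_apply _
  have hρ_inj : Function.Injective ρ := by
    intro r s h
    have := congrArg φ h
    rw [hρ, hρ] at this
    exact congrArg (fun w ↦ w.2.2) this
  have hconj (u : G) (r : P) : u * ρ r * u⁻¹ = ρ ((φ u).2.2 * r * (φ u).2.2⁻¹) := by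
    apply φ.injective
    rw [map_mul, map_mul, map_inv, hρ, hρ]
    ext1
    · simp
    · ext1 <;> simp
  have hn : ρ.range.Normal := ⟨by
    rintro _ ⟨r, rfl⟩ u
    exact ⟨_, (hconj u r).symm⟩⟩
  let e : P ≃* ρ.range := MonoidHom.ofInjective hρ_inj
  have hcard : Nat.card ρ.range = Nat.card P := (Nat.card_congr e.toEquiv).symm
  have hnil : relativeAugmentation F ρ.range ^ Nat.card P = ⊥ := by
    rcases hp with hp | ⟨p, hp, hF, hP⟩
    · rw [Nat.card_of_subsingleton (1 : P), Submodule.pow_one, eq_bot_iff]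
      refine Ideal.span_le.2 ?_
      rintro _ ⟨_, ⟨r, rfl⟩, rfl⟩
      rw [Subsingleton.elim r 1, map_one, map_one, sub_self]
      exact zero_mem _
    · have : Fact p.Prime := ⟨hp⟩
      have : Finite ρ.range := Finite.of_equiv P e.toEquiv
      rw [← hcard]
      refine relativeAugmentation_pow_card_eq_bot p ρ.range (hP.of_equiv e) fun u ↦ ?_
      refine ⟨ρ (φ u).2.2, ⟨_, rfl⟩, ?_⟩
      rintro _ ⟨r, rfl⟩
      rw [hconj]
      simp
  -- Modulo the relative augmentation ideal, each symmetric element is central.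
  have hsym : ∀ s ∈ symmetricElements F σ, ∃ c ∈ Set.center (MonoidAlgebra F G),
      s - c ∈ relativeAugmentation F ρ.range := by
    intro s hs
    replace hs := symmetricElements_subset_span σ h2 hs
    induction hs using Submodule.span_induction with
    | mem s hs =>
      obtain ⟨u, rfl⟩ := hs
      set r := (φ u).2.2 with hr
      set a := u * (ρ r)⁻¹ with ha
      have hua : u = a * ρ r := by rw [ha, inv_mul_cancel_right]
      have hφa : (φ a).2.2 = 1 := by rw [ha, map_mul, map_inv, hρ]; simp [hr]
      have hσr : σ (ρ r) = 1 := by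
        have h1 : σ (ρ r) ^ Nat.card P = 1 := by
          rw [← map_pow, ← map_pow, pow_card_eq_one', map_one, map_one]
        rcases Int.units_eq_one_or (σ (ρ r)) with h | h
        · exact h
        · rw [h, hodd.neg_one_pow] at h1; exact absurd h1 (by decide)
      have hc : a⁻¹ * (ρ r)⁻¹ = (ρ r)⁻¹ * a⁻¹ := by
        apply φ.injective
        rw [map_mul, map_mul, map_inv, map_inv, hρ]
        ext1
        · simp
        · ext1 <;> simp [hφa]
      refine ⟨symGen F σ a, symGen_mem_center hxy hE hodd ψ hg hgx hgy hg2 φ hφa, ?_⟩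
      have : symGen F σ u - symGen F σ a = of F G a * (of F G (ρ r) - 1) +
          single a⁻¹ (((σ a : ℤˣ) : ℤ) : F) * (of F G (ρ r)⁻¹ - 1) := by
        rw [hua]
        simp only [symGen, mul_sub, map_mul, hσr, mul_inv_rev, ← hc, MonoidAlgebra.of_apply,
          MonoidAlgebra.single_mul_single, mul_one]
        abel
      rw [this]
      exact add_mem (Ideal.mul_mem_left _ _ (of_sub_one_mem ⟨r, rfl⟩))
        (Ideal.mul_mem_left _ _ (of_sub_one_mem (inv_mem ⟨r, rfl⟩)))
    | zero => exact ⟨0, Set.zero_mem_center, by simp⟩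
    | add s t _ _ hs ht =>
      obtain ⟨c, hc, hsc⟩ := hs
      obtain ⟨d, hd, htd⟩ := ht
      refine ⟨c + d, Set.add_mem_center hc hd, ?_⟩
      rw [add_sub_add_comm]
      exact add_mem hsc htd
    | smul r s _ hs =>
      obtain ⟨c, hc, hsc⟩ := hs
      refine ⟨r • c, Set.smul_mem_center r hc, ?_⟩
      rw [← smul_sub, ← smul_one_mul]
      exact Ideal.mul_mem_left _ _ hsc
  rw [eq_bot_iff]
  intro a ha
  have := upperLiePower_subset_pow _ hsym _ a ha
  rw [hnil] at this
  exact this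

end Sufficiency

/-! ### Consequences of strong Lie nilpotency in characteristic `p` -/

section FrobeniusPowers

variable {F : Type*} [Field F] {G : Type*} [Group G] {σ : G →* ℤˣ}

/-- In characteristic `p`, the `q`-th power of the derivation `r ↦ r * s - s * r` is the commutator
with `s ^ q`, for `q` a power of `p`. -/
theorem commute_pow_of_upperLiePower_eq_bot {R : Type*} [Ring R] [Algebra F R] [Nontrivial R]
    (p : ℕ) [hp : Fact p.Prime] [CharP F p] {S : Set R} {n k : ℕ} (h : upperLiePower S n = ⊥)
    (hk : n ≤ p ^ k) {s : R} (hs : s ∈ S) (r : R) : Commute (s ^ p ^ k) r := by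
  have hmem (m : ℕ) : ((LinearMap.mulRight F s - LinearMap.mulLeft F s) ^ m) r ∈
      upperLiePower S (m + 1) := by
    induction m with
    | zero => exact mem_upperLiePower_one _
    | succ m ih =>
      rw [pow_succ']
      exact commutator_mem_upperLiePower ih hs
  have : CharP (Module.End F R) p :=
    charP_of_injective_algebraMap (algebraMap F (Module.End F R)).injective p
  have : ExpChar (Module.End F R) p := ExpChar.prime hp.out
  have h0 := upperLiePower_antitone S (hk.trans (Nat.le_succ _)) (hmem (p ^ k))
  rw [h, sub_pow_expChar_pow_of_commute _ _ (LinearMap.commute_mulLeft_right s s).symm,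
    LinearMap.pow_mulLeft, LinearMap.pow_mulRight] at h0
  exact (sub_eq_zero.1 h0).symm

variable {n k : ℕ}

theorem symGen_pow (p : ℕ) [hp : Fact p.Prime] [CharP F p] (hp2 : p ≠ 2) (g : G) :
    symGen F σ g ^ p ^ k = symGen F σ (g ^ p ^ k) := by
  have : CharP (MonoidAlgebra F G) p :=
    charP_of_injective_algebraMap (algebraMap F (MonoidAlgebra F G)).injective p
  have : ExpChar (MonoidAlgebra F G) p := ExpChar.prime hp.out
  have hodd : Odd (p ^ k) := (hp.out.odd_of_ne_two hp2).pow
  have hc : Commute (of F G g) (of F G g⁻¹) := ((Commute.refl g).inv_right).map _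
  rcases Int.units_eq_one_or (σ g) with hs | hs
  · rw [symGen_of_eq_one F hs, symGen_of_eq_one F (by rw [map_pow, hs, one_pow]),
      add_pow_expChar_pow_of_commute _ _ hc, ← map_pow, ← map_pow, inv_pow]
  · rw [symGen_of_eq_neg_one F hs,
      symGen_of_eq_neg_one F (by rw [map_pow, hs, hodd.neg_one_pow]),
      sub_pow_expChar_pow_of_commute _ _ hc, ← map_pow, ← map_pow, inv_pow]

theorem conj_pow_of_mem_ker (p : ℕ) [hp : Fact p.Prime] [CharP F p] (hp2 : p ≠ 2)
    (h : upperLiePower (symmetricElements F σ) n = ⊥)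
    (hk : n ≤ p ^ k) {g : G} (hg : σ g = 1) (u : G) :
    u * g ^ p ^ k = g ^ p ^ k * u ∨ u * g ^ p ^ k = (g ^ p ^ k)⁻¹ * u := by
  have h2 : (1 : F) + 1 ≠ 0 := by
    rw [one_add_one_eq_two]; exact Ring.two_ne_zero (by rwa [ringChar.eq F p])
  have hc := commute_pow_of_upperLiePower_eq_bot (F := F) p h hk (symGen_mem σ g) (of F G u)
  rw [symGen_pow p hp2, symGen_of_eq_one F (by rw [map_pow, hg, one_pow]), commute_iff_eq,
    add_mul, mul_add, ← map_mul, ← map_mul, ← map_mul, ← map_mul] at hc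
  rcases (MonoidAlgebra.single_add_single_inj one_ne_zero one_ne_zero).1 hc.symm with h | h | h
  · exact Or.inl h.1
  · exact Or.inr h.2.1
  · exact absurd h.1 h2

theorem conj_pow_of_not_mem_ker (p : ℕ) [hp : Fact p.Prime] [CharP F p] (hp2 : p ≠ 2)
    (h : upperLiePower (symmetricElements F σ) n = ⊥)
    (hk : n ≤ p ^ k) {g : G} (hg : σ g = -1) :
    g ^ p ^ k * g ^ p ^ k = 1 ∨ ∀ u, Commute (g ^ p ^ k) u := by
  have h2 : (2 : F) ≠ 0 := Ring.two_ne_zero (by rwa [ringChar.eq F p])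
  have hodd : Odd (p ^ k) := (hp.out.odd_of_ne_two hp2).pow
  refine or_iff_not_imp_left.2 fun hne u ↦ ?_
  have hc := commute_pow_of_upperLiePower_eq_bot (F := F) p h hk (symGen_mem σ g) (of F G u)
  rw [symGen_pow p hp2, symGen_of_eq_neg_one F (by rw [map_pow, hg, hodd.neg_one_pow]),
    commute_iff_eq, sub_mul, mul_sub, ← map_mul, ← map_mul, ← map_mul, ← map_mul,
    sub_eq_sub_iff_add_eq_add] at hc
  rcases (MonoidAlgebra.single_add_single_inj one_ne_zero one_ne_zero).1 hc with h | h | h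
  · exact h.1
  · refine absurd ?_ hne
    have := mul_right_cancel h.2.1
    nth_rw 2 [this]
    exact mul_inv_cancel _
  · exact absurd (by rw [← one_add_one_eq_two]; exact h.1) h2

end FrobeniusPowers

section AugmentationNilpotent

variable {F : Type*} [Field F] {G : Type*} [Group G] {σ : G →* ℤˣ} {x y : G}

/-- The elements that commute with `x` and `y` and are negated by the central involution `x * x` of
the quaternion group `⟨x, y⟩`. -/
structure IsQuaternionOdd (x y : G) (α : MonoidAlgebra F G) : Prop where
  comm_left : Commute α (of F G x)
  comm_right : Commute α (of F G y)
  neg : of F G (x * x) * α = -α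

theorem IsQuaternionOdd.mul_of_sub_one {α : MonoidAlgebra F G} (hα : IsQuaternionOdd x y α) {h : G}
    (hx : Commute h x) (hy : Commute h y) : IsQuaternionOdd x y (α * (of F G h - 1)) where
  comm_left := hα.comm_left.mul_left ((hx.map (of F G)).sub_left (Commute.one_left _))
  comm_right := hα.comm_right.mul_left ((hy.map (of F G)).sub_left (Commute.one_left _))
  neg := by rw [← mul_assoc, hα.neg, neg_mul]

/-- Commuting `α` and `y α` with the symmetric element `m x + (m x)⁻¹` produces, up to
units, `α d ∓ d α` with `d = m - m⁻¹`; the sign is due to `x` and `y` anticommuting modulo `x ^ 2 + 1`. -/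
theorem IsQuaternionOdd.mul_sq_sub_one_mem (h2 : (2 : F) ≠ 0)
    (hyx : y * x = x * y * (x * x)) (hσx : σ x = 1) {α : MonoidAlgebra F G}
    (hα : IsQuaternionOdd x y α) {i : ℕ} (hi : α ∈ upperLiePower (symmetricElements F σ) (i + 1))
    {m : G} (hσm : σ m = 1) (hmx : Commute m x) (hmy : Commute m y) :
    α * (of F G (m * m) - 1) ∈ upperLiePower (symmetricElements F σ) (i + 2) := by
  set I := upperLiePower (symmetricElements F σ) (i + 2)
  set X := of F G x with hX
  set X' := of F G x⁻¹ with hX'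
  set Y := of F G y with hY
  set M := of F G m with hM
  set M' := of F G m⁻¹ with hM'
  set s := symGen F σ (m * x) with hs
  set d := M - M' with hd
  have hMX : Commute M X := hmx.map (of F G)
  have hMX' : Commute M' X' := hmx.inv_inv.map (of F G)
  have hdX : Commute d X := hMX.sub_left (hmx.inv_left.map (of F G))
  have hdY : Commute d Y := (hmy.map (of F G)).sub_left (hmy.inv_left.map (of F G))
  have hXX' : X * X' = 1 := by rw [hX, hX', ← map_mul, mul_inv_cancel, map_one]
  have hX'X : X' * X = 1 := by rw [hX, hX', ← map_mul, inv_mul_cancel, map_one]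
  have hαX' : Commute α X' := by
    calc α * X' = X' * X * α * X' := by rw [hX'X, one_mul]
      _ = X' * α := by rw [mul_assoc X', ← hα.comm_left.eq, mul_assoc, mul_assoc, hXX', mul_one]
  have hneg : X * (X * α) = -α := by rw [← mul_assoc, hX, ← map_mul, hα.neg]
  have hX'α : X' * α = -(X * α) := by
    rw [← neg_eq_iff_eq_neg, ← mul_neg, ← hneg, ← mul_assoc, hX'X, one_mul]
  have hs : s = M * X + M' * X' := by
    rw [hs, symGen_of_eq_one F (by rw [map_mul, hσm, hσx, mul_one]), mul_inv_rev,
      ← hmx.inv_inv.eq, map_mul, map_mul]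
  have hαs : α * s = X * (α * d) := by
    rw [hs, hMX.eq, hMX'.eq, mul_add, ← mul_assoc, ← mul_assoc, hαX'.eq, hX'α, hα.comm_left.eq,
      hd, mul_sub, mul_sub]
    noncomm_ring
  have hsα : s * α = X * (d * α) := by
    rw [hs, add_mul, mul_assoc, mul_assoc, hX'α, ← mul_assoc X, ← hdX.eq, hd]
    noncomm_ring
  have hYX : Y * (X * α) = -(X * (Y * α)) := by
    have : Y * X = X * Y * of F G (x * x) := by
      rw [hX, hY, ← map_mul, ← map_mul, ← map_mul, hyx]
    rw [← mul_assoc, this, mul_assoc, hα.neg, mul_neg, mul_assoc]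
  have hsub : α * d - d * α ∈ I := by
    have h1 : α * s - s * α ∈ I := commutator_mem_upperLiePower hi (symGen_mem σ _)
    have h2 := I.mul_mem_left X' _ h1
    rwa [hαs, hsα, ← mul_sub, ← mul_assoc, hX'X, one_mul] at h2
  have hadd : α * d + d * α ∈ I := by
    have h1 : Y * α * s - s * (Y * α) ∈ I :=
      commutator_mem_upperLiePower (TwoSidedIdeal.mul_mem_left _ _ _ hi) (symGen_mem σ _)
    have e : Y * α * s - s * (Y * α) = -(X * (Y * (α * d + d * α))) := by
      have e1 : Y * α * s = -(X * (Y * (α * d))) := by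
        rw [mul_assoc, hαs, ← mul_assoc X, ← mul_assoc Y, hYX]; simp only [mul_assoc, neg_mul]
      have e2 : s * (Y * α) = X * (Y * (d * α)) := by
        rw [← hα.comm_right.eq, ← mul_assoc, hsα, mul_assoc, mul_assoc, hα.comm_right.eq,
          ← mul_assoc d, hdY.eq, mul_assoc]
      rw [e1, e2, mul_add, mul_add]
      abel
    rw [e] at h1
    have h2 := I.neg_mem (I.mul_mem_left (of F G y⁻¹ * X') _ h1)
    rwa [mul_neg, neg_neg, mul_assoc, ← mul_assoc X', hX'X, one_mul, ← mul_assoc, hY, ← map_mul,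
      inv_mul_cancel, map_one, one_mul] at h2
  have hαd : α * d ∈ I := by
    have h1 := I.mul_mem_left (algebraMap F _ (2⁻¹)) _ (I.add_mem hsub hadd)
    have e : α * d - d * α + (α * d + d * α) = algebraMap F (MonoidAlgebra F G) 2 * (α * d) := by
      rw [map_ofNat, two_mul]; abel
    rwa [e, ← mul_assoc, ← map_mul, inv_mul_cancel₀ h2, map_one, one_mul] at h1
  have h1 := I.mul_mem_right _ M hαd
  have e : α * d * M = α * (of F G (m * m) - 1) := by
    rw [mul_assoc, hd, sub_mul, hM, hM', ← map_mul, ← map_mul, inv_mul_cancel, map_one]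
  rwa [e] at h1

/-- The elements of `ker σ` that centralize `x` and `y`. -/
def kerCentralizer (σ : G →* ℤˣ) (x y : G) : Subgroup G :=
  σ.ker ⊓ Subgroup.centralizer {x, y}

theorem mem_kerCentralizer {m : G} :
    m ∈ kerCentralizer σ x y ↔ σ m = 1 ∧ Commute m x ∧ Commute m y := by
  rw [kerCentralizer, Subgroup.mem_inf, MonoidHom.mem_ker, Subgroup.mem_centralizer_iff]
  simp only [Set.mem_insert_iff, Set.mem_singleton_iff, forall_eq_or_imp, forall_eq, commute_iff_eq]
  exact and_congr_right fun _ ↦ and_congr eq_comm eq_comm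

/-- The subgroup generated by the squares of the elements of `ker σ` that centralize `x`
and `y`. -/
def squareSubgroup (σ : G →* ℤˣ) (x y : G) : Subgroup G :=
  Subgroup.closure {s | ∃ m ∈ kerCentralizer σ x y, s = m * m}

theorem squareSubgroup_le : squareSubgroup σ x y ≤ kerCentralizer σ x y := by
  refine (Subgroup.closure_le _).2 ?_
  rintro _ ⟨m, hm, rfl⟩
  exact mul_mem hm hm

theorem IsQuaternionOdd.mul_sub_one_mem (h2 : (2 : F) ≠ 0)
    (hyx : y * x = x * y * (x * x)) (hσx : σ x = 1) {α : MonoidAlgebra F G}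
    (hα : IsQuaternionOdd x y α) {i : ℕ} (hi : α ∈ upperLiePower (symmetricElements F σ) (i + 1))
    {h : G} (hh : h ∈ squareSubgroup σ x y) :
    α * (of F G h - 1) ∈ upperLiePower (symmetricElements F σ) (i + 2) := by
  induction hh using Subgroup.closure_induction with
  | mem _ hm =>
    obtain ⟨m, hm, rfl⟩ := hm
    obtain ⟨hσ, hmx, hmy⟩ := mem_kerCentralizer.1 hm
    exact hα.mul_sq_sub_one_mem h2 hyx hσx hi hσ hmx hmy
  | one =>
    rw [map_one, sub_self, mul_zero]
    exact TwoSidedIdeal.zero_mem _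
  | mul u v _ _ hu hv =>
    have e : α * (of F G (u * v) - 1) = α * (of F G u - 1) * of F G v + α * (of F G v - 1) := by
      rw [map_mul]; noncomm_ring
    rw [e]
    exact TwoSidedIdeal.add_mem _ (TwoSidedIdeal.mul_mem_right _ _ _ hu) hv
  | inv u _ hu =>
    have e : α * (of F G u⁻¹ - 1) = -(α * (of F G u - 1) * of F G u⁻¹) := by
      rw [mul_assoc, sub_mul, ← map_mul, mul_inv_cancel, map_one, ← mul_neg]; congr 1; noncomm_ring
    rw [e]
    exact TwoSidedIdeal.neg_mem _ (TwoSidedIdeal.mul_mem_right _ _ _ hu)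

theorem isQuaternionOdd_one_sub (hx4 : x * x * (x * x) = 1) (hyy : y * y = x * x) :
    IsQuaternionOdd x y (1 - of F G (x * x)) where
  comm_left := (Commute.one_left _).sub_left
    (((Commute.refl x).mul_left (Commute.refl x)).map (of F G))
  comm_right := (Commute.one_left _).sub_left
    ((hyy ▸ (Commute.refl y).mul_left (Commute.refl y) : Commute (x * x) y).map (of F G))
  neg := by rw [mul_sub, ← map_mul, hx4, map_one, mul_one, neg_sub]

theorem one_sub_of_ne_zero (hx2 : x * x ≠ 1) : (1 - of F G (x * x) : MonoidAlgebra F G) ≠ 0 := by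
  intro h
  have := MonoidAlgebra.of_injective (R := F) ((map_one (of F G)).trans (sub_eq_zero.1 h))
  exact hx2 this.symm

/-- The element `(1 - x ^ 2) * (h ^ q - 1) = (1 - x ^ 2) * (h - 1) ^ q` lies in a vanishing upper Lie
power. -/
theorem pow_eq_one_of_mem_squareSubgroup (p : ℕ) [hp : Fact p.Prime] [CharP F p] (h2 : (2 : F) ≠ 0)
    (hx4 : x * x * (x * x) = 1) (hx2 : x * x ≠ 1) (hyy : y * y = x * x)
    (hyx : y * x = x * y * (x * x)) (hσx : σ x = 1) {n k : ℕ}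
    (hU : upperLiePower (symmetricElements F σ) n = ⊥) (hk : n ≤ p ^ k)
    {h : G} (hh : h ∈ squareSubgroup σ x y) : h ^ p ^ k = 1 := by
  have hm := mem_kerCentralizer.1 (squareSubgroup_le hh)
  have key (j : ℕ) : IsQuaternionOdd x y ((1 - of F G (x * x)) * (of F G h - 1) ^ j) ∧
      (1 - of F G (x * x)) * (of F G h - 1) ^ j ∈
        upperLiePower (symmetricElements F σ) (j + 1) := by
    induction j with
    | zero =>
      rw [pow_zero, mul_one]
      exact ⟨isQuaternionOdd_one_sub hx4 hyy, mem_upperLiePower_one _⟩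
    | succ j ih =>
      rw [pow_succ, ← mul_assoc]
      exact ⟨ih.1.mul_of_sub_one hm.2.1 hm.2.2, ih.1.mul_sub_one_mem h2 hyx hσx ih.2 hh⟩
  have h0 := upperLiePower_antitone _ (hk.trans (Nat.le_succ _)) (key (p ^ k)).2
  have : CharP (MonoidAlgebra F G) p :=
    charP_of_injective_algebraMap (algebraMap F (MonoidAlgebra F G)).injective p
  have : ExpChar (MonoidAlgebra F G) p := ExpChar.prime hp.out
  rw [hU, sub_pow_expChar_pow_of_commute _ _ (Commute.one_right _), one_pow, ← map_pow] at h0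
  replace h0 : (1 - of F G (x * x)) * (of F G (h ^ p ^ k) - 1) = 0 := h0
  have h1 : of F G (h ^ p ^ k) + of F G (x * x) = of F G 1 + of F G (x * x * h ^ p ^ k) := by
    rw [map_mul _ (x * x), map_one, ← sub_eq_zero, ← h0]
    noncomm_ring
  rcases (MonoidAlgebra.single_add_single_inj one_ne_zero one_ne_zero).1 h1 with h | h | h
  · exact h.1
  · exact absurd h.2.2 hx2
  · exact absurd (by rw [← one_add_one_eq_two]; exact h.1) h2

/-- A nonzero element of the group algebra annihilated by all `h - 1`, with `h` in a subgroup, has a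
finite support that is stable under that subgroup. -/
theorem finite_of_mul_of_sub_one_eq_zero {W : Subgroup G} {α : MonoidAlgebra F G} (hα : α ≠ 0)
    (h : ∀ w ∈ W, α * (of F G w - 1) = 0) : Finite W := by
  obtain ⟨g, hg⟩ : ∃ g, α.coeff g ≠ 0 := by
    by_contra! hc
    exact hα (MonoidAlgebra.ext (Finsupp.ext hc))
  have hw (w : W) : α.coeff (g * w) ≠ 0 := by
    have h1 : α * of F G w = α := by
      have := h w w.2
      rwa [mul_sub, mul_one, sub_eq_zero] at this
    rw [← h1]
    simpa [MonoidAlgebra.coeff_mul_single_apply] using hg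
  refine Finite.of_injective
    (fun w : W ↦ (⟨g * w, Finsupp.mem_support_iff.2 (hw w)⟩ : α.coeff.support)) fun v w e ↦ ?_
  exact Subtype.ext (mul_left_cancel (congrArg Subtype.val e))

/-- If the subgroup were infinite, no nonzero element would be annihilated by all its `h - 1`, and
multiplying `1 - x ^ 2` by suitable factors `h - 1` would give nonzero elements of all upper Lie
powers. -/
theorem finite_squareSubgroup (h2 : (2 : F) ≠ 0)
    (hx4 : x * x * (x * x) = 1) (hx2 : x * x ≠ 1) (hyy : y * y = x * x)
    (hyx : y * x = x * y * (x * x)) (hσx : σ x = 1) {n : ℕ}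
    (hU : upperLiePower (symmetricElements F σ) n = ⊥) : Finite (squareSubgroup σ x y) := by
  by_contra hinf
  have key (j : ℕ) : ∃ α : MonoidAlgebra F G, α ≠ 0 ∧ IsQuaternionOdd x y α ∧
      α ∈ upperLiePower (symmetricElements F σ) (j + 1) := by
    induction j with
    | zero => exact ⟨_, one_sub_of_ne_zero hx2, isQuaternionOdd_one_sub hx4 hyy,
        mem_upperLiePower_one _⟩
    | succ j ih =>
      obtain ⟨α, hα0, hα, hj⟩ := ih
      have : ¬ ∀ w ∈ squareSubgroup σ x y, α * (of F G w - 1) = 0 :=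
        fun h ↦ hinf (finite_of_mul_of_sub_one_eq_zero hα0 h)
      push Not at this
      obtain ⟨w, hw, hne⟩ := this
      have hm := mem_kerCentralizer.1 (squareSubgroup_le hw)
      exact ⟨_, hne, hα.mul_of_sub_one hm.2.1 hm.2.2, hα.mul_sub_one_mem h2 hyx hσx hj hw⟩
  obtain ⟨α, hα0, -, hα⟩ := key n
  have h0 := upperLiePower_antitone _ (Nat.le_succ n) hα
  rw [hU] at h0
  exact hα0 h0

end AugmentationNilpotent

/-! ### The splitting of the group -/

section Necessity

theorem nonempty_mulEquiv_prod {K A B C : Type*} [Group K] [Group A] [Group B] [Group C]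
    (f : A →* K) (e : B →* K) (r : C →* K) (hfe : ∀ a b, Commute (f a) (e b))
    (hfr : ∀ a c, Commute (f a) (r c)) (her : ∀ b c, Commute (e b) (r c))
    (hsurj : ∀ k, ∃ a b c, k = f a * (e b * r c))
    (hinj : ∀ a b c, f a * (e b * r c) = 1 → a = 1 ∧ b = 1 ∧ c = 1) :
    Nonempty (K ≃* A × B × C) := by
  let Φ : A × B × C →* K := f.noncommCoprod (e.noncommCoprod r her)
    fun a b ↦ (hfe a b.1).mul_right (hfr a b.2)
  refine ⟨(MulEquiv.ofBijective Φ ⟨?_, ?_⟩).symm⟩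
  · rw [injective_iff_map_eq_one]
    rintro ⟨a, b, c⟩ h
    obtain ⟨rfl, rfl, rfl⟩ := hinj a b c h
    rfl
  · intro k
    obtain ⟨a, b, c, rfl⟩ := hsurj k
    exact ⟨(a, b, c), rfl⟩

/-- In a group of exponent two, every element `z ≠ 1` has a complement: the kernel of a linear
functional over the field with two elements that does not vanish at `z`. -/
theorem exists_index_two_complement {T : Type*} [Group T] (hT : ∀ t : T, t ^ 2 = 1) {z : T}
    (hz : z ≠ 1) : ∃ E : Subgroup T, z ∉ E ∧ ∀ t, t ∈ E ∨ z * t ∈ E := by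
  let _ : CommGroup T := { ‹Group T› with mul_comm := mul_comm_of_sq_eq_one hT }
  let _ : Module (ZMod 2) (Additive T) := AddCommGroup.zmodModule fun t ↦ hT t.toMul
  obtain ⟨f, hf⟩ : ∃ f : Module.Dual (ZMod 2) (Additive T), f (Additive.ofMul z) ≠ 0 := by
    by_contra! h
    exact hz ((Module.forall_dual_apply_eq_zero_iff (ZMod 2) (Additive.ofMul z)).1 h)
  have hcases : ∀ a : ZMod 2, a = 0 ∨ a = 1 := by decide
  have h1 : f (Additive.ofMul z) = 1 := (hcases _).resolve_left hf
  refine ⟨(AddMonoidHom.toMultiplicativeRight f.toAddMonoidHom).ker, hf, fun t ↦ ?_⟩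
  have hmem (t : T) : t ∈ (AddMonoidHom.toMultiplicativeRight f.toAddMonoidHom).ker ↔
      f (Additive.ofMul t) = 0 := Iff.rfl
  rw [hmem, hmem, ofMul_mul, map_add, h1]
  rcases hcases (f (Additive.ofMul t)) with h | h
  · exact Or.inl h
  · right
    rw [h]
    decide

variable {G : Type*} [Group G] {x y : G}

theorem quaternion_relations (hxy : Nonempty (Subgroup.closure {x, y} ≃* QuaternionGroup 2)) :
    x * x * (x * x) = 1 ∧ x * x ≠ 1 ∧ y * y = x * x ∧ y * x = x * y * (x * x) := by
  obtain ⟨i, hinj, hi⟩ := exists_quaternion_hom hxy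
  have hne := mul_ne_of_closure_equiv_quaternion hxy
  obtain ⟨q, rfl⟩ : x ∈ i.range := hi ▸ Subgroup.subset_closure (by simp)
  obtain ⟨r, rfl⟩ : y ∈ i.range := hi ▸ Subgroup.subset_closure (by simp)
  have hqr : q * r ≠ r * q := fun h ↦ hne (by rw [← map_mul, ← map_mul, h])
  have hq := quaternion_sq_of_not_comm q r hqr
  have hr := quaternion_sq_of_not_comm r q (Ne.symm hqr)
  refine ⟨?_, ?_, ?_, ?_⟩
  · rw [← map_mul, ← map_mul, hq, ← map_one i]; exact congrArg i (by decide)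
  · rw [← map_mul, hq, ← map_one i]; exact fun h ↦ absurd (hinj h) (by decide)
  · rw [← map_mul, ← map_mul, hq, hr]
  · rw [← map_mul, ← map_mul, ← map_mul, ← map_mul, hq,
      (quaternion_mul_comm_or q r).resolve_left (Ne.symm hqr)]

/-- The group theory of the necessity: conditions on `q`-th powers that follow from strong Lie
nilpotency force the splitting. -/
theorem exists_splitting_of_pow_conditions {σ : G →* ℤˣ} (hσ : σ ≠ 1)
    (hxy : Nonempty (Subgroup.closure {x, y} ≃* QuaternionGroup 2)) {q : ℕ} (hq : q % 4 = 1)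
    (hN : ∀ g, σ g = 1 → ∀ u, u * g ^ q = g ^ q * u ∨ u * g ^ q = (g ^ q)⁻¹ * u)
    (hO : ∀ g, σ g = -1 → g ^ q * g ^ q = 1 ∨ ∀ u, Commute (g ^ q) u)
    (hW : σ x = 1 → ∀ h ∈ squareSubgroup σ x y, h ^ q = 1) :
    σ x = 1 ∧ ∃ E : Subgroup G, (∀ e : E, e ^ 2 = 1) ∧
      Nonempty (σ.ker ≃* QuaternionGroup 2 × E × squareSubgroup σ x y) ∧
      ∃ g : G, g ∉ σ.ker ∧ Commute g x ∧ Commute g y ∧ g ^ 2 = x ^ 2 ∧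
        Nonempty (G ≃* Subgroup.closure {x, y, g} × E × squareSubgroup σ x y) := by
  obtain ⟨hx4, hx2, hyy, hyx⟩ := quaternion_relations hxy
  have hne := mul_ne_of_closure_equiv_quaternion hxy
  obtain ⟨i, hinj, hi⟩ := exists_quaternion_hom hxy
  obtain ⟨j, rfl⟩ : ∃ j, q = 4 * j + 1 := ⟨q / 4, by omega⟩
  set q := 4 * j + 1 with hqdef
  have hqodd : Odd q := ⟨2 * j, by omega⟩
  have hpow4 {a : G} (h : a * a * (a * a) = 1) : a ^ q = a := by
    have : a ^ 4 = 1 := by rw [← h, ← pow_two, ← pow_two, ← pow_mul]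
    rw [hqdef, pow_succ, pow_mul, this, one_pow, one_mul]
  have hxq : x ^ q = x := hpow4 hx4
  have hyq : y ^ q = y := hpow4 (by rw [hyy, hx4])
  have hσ_or (u : G) := Int.units_eq_one_or (σ u)
  have hσx : σ x = 1 := by
    refine (hσ_or x).resolve_right fun h ↦ ?_
    have := hO x h
    rw [hxq] at this
    rcases this with h | h
    · exact hx2 h
    · exact hne (h y).eq
  have hσy : σ y = 1 := by
    refine (hσ_or y).resolve_right fun h ↦ ?_
    have := hO y h
    rw [hyq, hyy] at this
    rcases this with h | h
    · exact hx2 h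
    · exact hne (h x).eq.symm
  replace hW := hW hσx
  set W := squareSubgroup σ x y
  set M := kerCentralizer σ x y
  refine ⟨hσx, ?_⟩
  have hinvx : x⁻¹ = x * (x * x) := by rw [inv_eq_iff_mul_eq_one, ← mul_assoc, hx4]
  have hzy : Commute (x * x) y := hyy ▸ (Commute.refl y).mul_left (Commute.refl y)
  have hyx' : y * x = x⁻¹ * y := by rw [hyx, mul_assoc, ← hzy.eq, ← mul_assoc, hinvx]
  have hxy' : x * y = y⁻¹ * x := by
    rw [eq_inv_mul_iff_mul_eq, ← mul_assoc, hyx', mul_assoc, hyy, ← mul_assoc, inv_mul_cancel, one_mul]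
  -- `G` acts on `⟨x, y⟩` by inner automorphisms of `⟨x, y⟩`.
  have hdecomp (u : G) : ∃ w ∈ Subgroup.closure {x, y}, ∃ c, Commute c x ∧ Commute c y ∧
      u = w * c := by
    have mk (w : G) (hw : w ∈ Subgroup.closure {x, y}) (hx : w * x * w⁻¹ = u * x * u⁻¹)
        (hy : w * y * w⁻¹ = u * y * u⁻¹) : ∃ w ∈ Subgroup.closure {x, y}, ∃ c, Commute c x ∧
        Commute c y ∧ u = w * c := by
      have h (a : G) (ha : w * a * w⁻¹ = u * a * u⁻¹) : Commute (w⁻¹ * u) a := by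
        rw [commute_iff_eq, mul_assoc, inv_mul_eq_iff_eq_mul]
        rw [eq_mul_inv_iff_mul_eq] at ha
        rw [← ha]
        simp only [mul_assoc]
      exact ⟨w, hw, w⁻¹ * u, h x hx, h y hy, by group⟩
    have hxm : x ∈ Subgroup.closure {x, y} := Subgroup.subset_closure (by simp)
    have hym : y ∈ Subgroup.closure {x, y} := Subgroup.subset_closure (by simp)
    have hux := hN x hσx u
    have huy := hN y hσy u
    rw [hxq, ← mul_inv_eq_iff_eq_mul, ← mul_inv_eq_iff_eq_mul] at hux
    rw [hyq, ← mul_inv_eq_iff_eq_mul, ← mul_inv_eq_iff_eq_mul] at huy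
    rcases hux with hux | hux <;> rcases huy with huy | huy
    · refine mk 1 (one_mem _) ?_ ?_
      · rw [hux]; group
      · rw [huy]; group
    · refine mk x hxm ?_ ?_
      · rw [hux]; group
      · rw [huy, hxy']; group
    · refine mk y hym ?_ ?_
      · rw [hux, hyx']; group
      · rw [huy]; group
    · refine mk (x * y) (mul_mem hxm hym) ?_ ?_
      · rw [hux, mul_assoc x, hyx', mul_inv_cancel_left, mul_inv_rev, ← mul_assoc,
          mul_inv_cancel, one_mul]
      · rw [huy, mul_inv_rev, mul_assoc (x * y), mul_inv_cancel_left, hxy', mul_inv_cancel_right]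
  -- Powers of elements of the centralizer of `⟨x, y⟩`.
  have hmul_pow {c : G} (hcx : Commute c x) : (c * x) ^ q = c ^ q * x := by
    rw [hcx.mul_pow, hxq]
  have hnoty {c : G} (hcy : Commute c y) : y * (c * x) ≠ c * x * y := by
    intro h
    rw [← mul_assoc, ← hcy.eq, mul_assoc, mul_assoc] at h
    exact hne (mul_left_cancel h).symm
  have hM2 {m : G} (hm : m ∈ M) : m ^ q * m ^ q = 1 := by
    obtain ⟨hmσ, hmx, hmy⟩ := mem_kerCentralizer.1 hm
    have h1 := hN (m * x) (by rw [map_mul, hmσ, hσx, one_mul]) y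
    rw [hmul_pow hmx] at h1
    have h2 := h1.resolve_left (hnoty (hmy.pow_left q))
    rw [← mul_assoc, ← (hmy.pow_left q).eq, mul_assoc, hyx', mul_inv_rev,
      ← ((hmx.pow_left q).inv_inv).eq, mul_assoc] at h2
    have h3 := mul_right_cancel h2
    nth_rw 1 [h3]
    exact inv_mul_cancel _
  have hMc {m : G} (hm : m ∈ M) (u : G) : Commute (m ^ q) u := by
    rcases hN m (mem_kerCentralizer.1 hm).1 u with h | h
    · exact h.symm
    · rw [inv_eq_of_mul_eq_one_left (hM2 hm)] at h
      exact h.symm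
  -- An element outside the kernel yields `g`.
  obtain ⟨g, hσg, hgc, hg2⟩ : ∃ g, σ g = -1 ∧ (∀ u, Commute g u) ∧ g * g = x * x := by
    obtain ⟨u, hu⟩ : ∃ u, σ u = -1 := by
      by_contra! h
      exact hσ (MonoidHom.ext fun u ↦ (hσ_or u).resolve_right (h u))
    obtain ⟨w, hw, c, hcx, hcy, rfl⟩ := hdecomp u
    have hσw : σ w = 1 := by
      have : Subgroup.closure {x, y} ≤ σ.ker := by
        rw [Subgroup.closure_le]
        rintro _ (rfl | rfl)
        · exact hσx
        · exact hσy
      exact this hw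
    have hσc : σ c = -1 := by rwa [map_mul, hσw, one_mul] at hu
    have h1 : c ^ q * c ^ q = x * x := by
      have h := hO (c * x) (by rw [map_mul, hσc, hσx, mul_one])
      rw [hmul_pow hcx] at h
      have h2 := h.resolve_right fun h ↦ hnoty (hcy.pow_left q) (h y).eq.symm
      rw [mul_assoc, ← mul_assoc x, ← (hcx.pow_left q).eq, mul_assoc, ← mul_assoc] at h2
      have h3 := eq_inv_of_mul_eq_one_left h2
      rw [h3, inv_eq_iff_mul_eq_one, hx4]
    refine ⟨c ^ q, by rw [map_pow, hσc, hqodd.neg_one_pow], ?_, h1⟩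
    exact (hO c hσc).resolve_left fun h ↦ hx2 (by rw [← h1, h])
  -- The central involutions in the kernel, and a complement to `x ^ 2` among them.
  let T : Subgroup G :=
    { carrier := {t | σ t = 1 ∧ t * t = 1 ∧ ∀ u, Commute t u}
      one_mem' := ⟨map_one σ, mul_one 1, fun u ↦ Commute.one_left u⟩
      mul_mem' := by
        rintro s t ⟨hs, hs2, hsc⟩ ⟨ht, ht2, htc⟩
        refine ⟨by rw [map_mul, hs, ht, one_mul], ?_, fun u ↦ (hsc u).mul_left (htc u)⟩
        rw [mul_assoc, ← mul_assoc t, (htc s).eq, mul_assoc, ht2, mul_one, hs2]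
      inv_mem' := by
        rintro t ⟨ht, ht2, htc⟩
        exact ⟨by rw [map_inv, ht, inv_one], by rw [← mul_inv_rev, ht2, inv_one],
          fun u ↦ (htc u).inv_left⟩ }
  have hzT : x * x ∈ T := ⟨by rw [map_mul, hσx, one_mul], hx4, fun u ↦ by
    rw [← hg2]; exact (hgc u).mul_left (hgc u)⟩
  obtain ⟨E', hzE', hE'⟩ := exists_index_two_complement (T := T)
    (fun t ↦ Subtype.ext (by rw [pow_two]; exact t.2.2.1)) (z := ⟨x * x, hzT⟩)
    (fun h ↦ hx2 (congrArg Subtype.val h))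
  set E := E'.map T.subtype
  have hET : E ≤ T := Subgroup.map_subtype_le E'
  have hzE : x * x ∉ E := by
    rintro ⟨t, ht, h⟩
    have ht' : t = ⟨x * x, hzT⟩ := Subtype.ext h
    exact hzE' (ht' ▸ ht)
  have hTE {t : G} (ht : t ∈ T) : t ∈ E ∨ x * x * t ∈ E :=
    (hE' ⟨t, ht⟩).imp (fun h ↦ ⟨_, h, rfl⟩) fun h ↦ ⟨_, h, rfl⟩
  have hWM : W ≤ M := squareSubgroup_le
  have hiz : i (.a 2) = x * x := by
    obtain ⟨qx, hqx⟩ : x ∈ i.range := hi ▸ Subgroup.subset_closure (by simp)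
    obtain ⟨qy, hqy⟩ : y ∈ i.range := hi ▸ Subgroup.subset_closure (by simp)
    rw [← hqx, ← map_mul, quaternion_sq_of_not_comm qx qy fun h ↦ hne (by
      rw [← hqx, ← hqy, ← map_mul, ← map_mul, h])]
  have hσi (r) : σ (i r) = 1 := by
    have : Subgroup.closure {x, y} ≤ σ.ker := by
      rw [Subgroup.closure_le]
      rintro _ (rfl | rfl)
      · exact hσx
      · exact hσy
    exact this (hi ▸ ⟨r, rfl⟩)
  have hcommi {c : G} (hcx : Commute c x) (hcy : Commute c y) (r) : Commute (i r) c := by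
    have : Subgroup.closure {x, y} ≤ Subgroup.centralizer {c} := by
      rw [Subgroup.closure_le]
      rintro _ (rfl | rfl)
      · exact Subgroup.mem_centralizer_singleton_iff.2 hcx.eq.symm
      · exact Subgroup.mem_centralizer_singleton_iff.2 hcy.eq.symm
    exact Subgroup.mem_centralizer_singleton_iff.1 (this (hi ▸ ⟨r, rfl⟩))
  -- Existence of the decomposition in the kernel.
  have hex {u : G} (hu : σ u = 1) : ∃ r, ∃ e ∈ E, ∃ w ∈ W, u = i r * (e * w) := by
    obtain ⟨v, hv, m, hmx, hmy, rfl⟩ := hdecomp u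
    obtain ⟨r, rfl⟩ : v ∈ i.range := hi ▸ hv
    have hm : m ∈ M := mem_kerCentralizer.2
      ⟨by rwa [map_mul, hσi, one_mul] at hu, hmx, hmy⟩
    have ht : m ^ q ∈ T := ⟨by rw [map_pow, (mem_kerCentralizer.1 hm).1, one_pow], hM2 hm, hMc hm⟩
    have hw : (m * m)⁻¹ ^ (2 * j) ∈ W :=
      pow_mem (inv_mem (show m * m ∈ W from Subgroup.subset_closure ⟨m, hm, rfl⟩)) _
    have hmw : m = m ^ q * (m * m)⁻¹ ^ (2 * j) := by
      have h : m ^ q = m * (m * m) ^ (2 * j) := by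
        rw [← pow_two, ← pow_mul, ← pow_succ', hqdef]
        congr 1
        omega
      rw [inv_pow, h, mul_inv_cancel_right]
    rcases hTE ht with h | h
    · exact ⟨r, _, h, _, hw, by rw [← hmw]⟩
    · refine ⟨r * .a 2, _, h, _, hw, ?_⟩
      rw [map_mul, hiz, mul_assoc (i r), ← mul_assoc (x * x), ← mul_assoc (x * x), hx4, one_mul,
        ← hmw]
  -- Uniqueness of the decomposition in the kernel.
  have huniq {r} {e w : G} (he : e ∈ E) (hw : w ∈ W) (h : i r * (e * w) = 1) :
      r = 1 ∧ e = 1 ∧ w = 1 := by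
    have hmw := mem_kerCentralizer.1 (hWM hw)
    obtain ⟨-, he2, hec⟩ := hET he
    have hir : i r = (e * w)⁻¹ := eq_inv_of_mul_eq_one_left h
    have hcr (s) : s * r = r * s := by
      apply hinj
      rw [map_mul, map_mul, hir]
      exact (hcommi ((hec x).mul_left hmw.2.1).inv_left ((hec y).mul_left hmw.2.2).inv_left s).eq
    have hr : r = 1 ∨ r = .a 2 := quaternion_eq_of_central r hcr
    have hr2 : i r * i r = 1 := by
      rcases hr with rfl | rfl
      · simp
      · rw [hiz, hx4]
    have hw2 : w * w = 1 := by
      rw [hir, ← mul_inv_rev, inv_eq_one, mul_assoc, ← mul_assoc w, ← (hec w).eq, mul_assoc e,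
        ← mul_assoc e, he2, one_mul] at hr2
      exact hr2
    have hw1 : w = 1 := by
      have := hW w hw
      rwa [hpow4 (by rw [hw2, one_mul])] at this
    rw [hw1, mul_one] at h
    have he' : e = i r := by
      rw [eq_comm, eq_inv_of_mul_eq_one_left h, inv_eq_iff_mul_eq_one, he2]
    rcases hr with rfl | rfl
    · exact ⟨rfl, by rw [he', map_one], hw1⟩
    · exact absurd (by rw [← hiz, ← he']; exact he) hzE
  have hEσ {e : G} (he : e ∈ E) : σ e = 1 := (hET he).1
  have hWσ {w : G} (hw : w ∈ W) : σ w = 1 := (mem_kerCentralizer.1 (hWM hw)).1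
  have hEk : E ≤ σ.ker := fun e he ↦ hEσ he
  have hWk : W ≤ σ.ker := fun w hw ↦ hWσ hw
  have hle : Subgroup.closure {x, y} ≤ Subgroup.closure {x, y, g} :=
    Subgroup.closure_mono (by intro s; simp; tauto)
  have hgm : g ∈ Subgroup.closure {x, y, g} := Subgroup.subset_closure (by simp)
  have him (r) : i r ∈ Subgroup.closure {x, y, g} := hle (hi ▸ ⟨r, rfl⟩)
  refine ⟨E, fun e ↦ Subtype.ext (by rw [pow_two]; exact (hET e.2).2.1), ?_, g, ?_, hgc x, hgc y,
    by rw [pow_two, pow_two, hg2], ?_⟩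
  · refine nonempty_mulEquiv_prod (i.codRestrict σ.ker hσi) (Subgroup.inclusion hEk)
      (Subgroup.inclusion hWk) ?_ ?_ ?_ ?_ ?_
    · exact fun a b ↦ Subtype.ext ((hET b.2).2.2 _).eq.symm
    · intro a c
      have := mem_kerCentralizer.1 (hWM c.2)
      exact Subtype.ext (hcommi this.2.1 this.2.2 a).eq
    · exact fun b c ↦ Subtype.ext ((hET b.2).2.2 _).eq
    · rintro ⟨u, hu⟩
      obtain ⟨r, e, he, w, hw, h⟩ := hex hu
      exact ⟨r, ⟨e, he⟩, ⟨w, hw⟩, Subtype.ext h⟩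
    · intro r e w h
      obtain ⟨h1, h2, h3⟩ := huniq e.2 w.2 (congrArg Subtype.val h)
      exact ⟨h1, Subtype.ext h2, Subtype.ext h3⟩
  · rw [MonoidHom.mem_ker, hσg]
    decide
  · have hcommg {c : G} (hcx : Commute c x) (hcy : Commute c y) {h : G}
        (hh : h ∈ Subgroup.closure {x, y, g}) : Commute h c := by
      have : Subgroup.closure {x, y, g} ≤ Subgroup.centralizer {c} := by
        rw [Subgroup.closure_le]
        rintro _ (rfl | rfl | rfl)
        · exact Subgroup.mem_centralizer_singleton_iff.2 hcx.eq.symm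
        · exact Subgroup.mem_centralizer_singleton_iff.2 hcy.eq.symm
        · exact Subgroup.mem_centralizer_singleton_iff.2 (hgc c).eq
      exact Subgroup.mem_centralizer_singleton_iff.1 (this hh)
    -- The elements of `⟨x, y, g⟩` in the kernel of `σ` lie in `⟨x, y⟩`.
    have hker {h : G} (hh : h ∈ Subgroup.closure {x, y, g}) (hσh : σ h = 1) : ∃ r, h = i r := by
      obtain ⟨r, k, ⟨n, hn⟩, rfl⟩ := exists_mul_of_mem_closure (K := Subgroup.zpowers g) hi
        (by rintro _ ⟨n, rfl⟩; exact (hgc x).zpow_left n)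
        (by rintro _ ⟨n, rfl⟩; exact (hgc y).zpow_left n)
        (by
          rintro s (rfl | rfl | rfl)
          · exact Or.inl rfl
          · exact Or.inr (Or.inl rfl)
          · exact Or.inr (Or.inr (Subgroup.mem_zpowers s))) hh
      change g ^ n = k at hn
      subst hn
      rw [map_mul, hσi, one_mul, map_zpow, hσg] at hσh
      rcases Int.even_or_odd' n with ⟨m, rfl | rfl⟩
      · refine ⟨r * .a 2 ^ m, ?_⟩
        rw [zpow_mul, show g ^ (2 : ℤ) = x * x by rw [← hg2]; exact zpow_two g, map_mul, map_zpow,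
          hiz]
      · rw [zpow_add, zpow_mul] at hσh
        exact absurd hσh (by simp)
    refine nonempty_mulEquiv_prod (Subgroup.subtype _) E.subtype W.subtype ?_ ?_ ?_ ?_ ?_
    · exact fun a b ↦ ((hET b.2).2.2 _).symm
    · intro a c
      have := mem_kerCentralizer.1 (hWM c.2)
      exact hcommg this.2.1 this.2.2 a.2
    · exact fun b c ↦ (hET b.2).2.2 _
    · intro u
      rcases hσ_or u with hu | hu
      · obtain ⟨r, e, he, w, hw, h⟩ := hex hu
        exact ⟨⟨i r, him r⟩, ⟨e, he⟩, ⟨w, hw⟩, h⟩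
      · obtain ⟨r, e, he, w, hw, h⟩ := hex (u := g⁻¹ * u)
          (by rw [map_mul, map_inv, hσg, hu]; decide)
        refine ⟨⟨g * i r, mul_mem hgm (him r)⟩, ⟨e, he⟩, ⟨w, hw⟩, ?_⟩
        change u = g * i r * (e * w)
        rw [mul_assoc, ← h, mul_inv_cancel_left]
    · rintro ⟨h, hh⟩ ⟨e, he⟩ ⟨w, hw⟩ h1
      change h * (e * w) = 1 at h1
      have hσh : σ h = 1 := by
        have := congrArg σ h1
        rwa [map_mul, map_mul, hEσ he, hWσ hw, one_mul, mul_one, map_one] at this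
      obtain ⟨r, rfl⟩ := hker hh hσh
      obtain ⟨rfl, rfl, rfl⟩ := huniq he hw h1
      exact ⟨Subtype.ext (map_one i), rfl, rfl⟩

end Necessity

/-! ### The characterization -/

section Main

theorem exists_splitting_of_isStronglyLieNilpotent {F : Type*} [Field F] (p : ℕ)
    [hp : Fact p.Prime] [CharP F p] (hp2 : p ≠ 2) {G : Type u} [Group G] {σ : G →* ℤˣ} (hσ : σ ≠ 1)
    {x y : G} (hxy : Nonempty (Subgroup.closure {x, y} ≃* QuaternionGroup 2))
    (h : IsStronglyLieNilpotent (symmetricElements F σ)) :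
    ∃ (E P : Type u) (_ : Group E) (_ : Group P), HasQuaternionPSplitting p σ x y E P := by
  obtain ⟨n, -, hn⟩ := h
  have h2 : (2 : F) ≠ 0 := Ring.two_ne_zero (by rwa [ringChar.eq F p])
  obtain ⟨hx4, hx2, hyy, hyx⟩ := quaternion_relations hxy
  have hk : n ≤ p ^ (2 * n) :=
    (by omega : n ≤ 2 * n).trans (Nat.lt_pow_self hp.out.one_lt).le
  -- An even power of an odd prime is congruent to one modulo four.
  have hmod : p ^ (2 * n) % 4 = 1 := by
    have hodd := Nat.odd_iff.1 (hp.out.odd_of_ne_two hp2)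
    have h1 : p ^ 2 % 4 = 1 := by
      rw [Nat.pow_mod]
      rcases (by omega : p % 4 = 1 ∨ p % 4 = 3) with h | h <;> rw [h]
    rw [pow_mul, Nat.pow_mod, h1, one_pow, Nat.one_mod]
  obtain ⟨hσx, E, hE, hN, hG⟩ := exists_splitting_of_pow_conditions hσ hxy hmod
    (fun g hg ↦ conj_pow_of_mem_ker p hp2 hn hk hg)
    (fun g hg ↦ conj_pow_of_not_mem_ker p hp2 hn hk hg)
    (fun hσx w hw ↦ pow_eq_one_of_mem_squareSubgroup p h2 hx4 hx2 hyy hyx hσx hn hk hw)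
  refine ⟨E, squareSubgroup σ x y, inferInstance, inferInstance, hE,
    finite_squareSubgroup h2 hx4 hx2 hyy hyx hσx hn, fun w ↦ ⟨2 * n, Subtype.ext ?_⟩, hN, hG⟩
  exact pow_eq_one_of_mem_squareSubgroup p h2 hx4 hx2 hyy hyx hσx hn hk w.2

theorem eq_one_of_pow_eq_one_of_coprime {A : Type*} [Group A] {a : A} {m l : ℕ} (hm : a ^ m = 1)
    (hl : a ^ l = 1) (h : Nat.Coprime m l) : a = 1 := by
  have := Nat.dvd_gcd (orderOf_dvd_of_pow_eq_one hm) (orderOf_dvd_of_pow_eq_one hl)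
  rwa [h, Nat.dvd_one, orderOf_eq_one_iff] at this

/-- The second splitting leaves no room for an element of order three, so the `3`-group of the first
one is trivial. -/
theorem subsingleton_of_splitting_three_five {K E P E' P' : Type*} [Group K] [Group E] [Group P]
    [Group E'] [Group P'] (hP : IsPGroup 3 P) (hE' : ∀ e : E', e ^ 2 = 1) (hP' : IsPGroup 5 P')
    (φ : K ≃* QuaternionGroup 2 × E × P) (φ' : K ≃* QuaternionGroup 2 × E' × P') :
    Subsingleton P := by
  refine subsingleton_of_forall_eq 1 fun w ↦ ?_
  obtain ⟨k, hk⟩ := hP w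
  set v := φ' (φ.symm (1, 1, w)) with hv
  have h1 : v ^ 3 ^ k = 1 := by
    rw [hv, ← map_pow, ← map_pow, Prod.pow_mk, Prod.pow_mk, hk, one_pow, one_pow]
    exact (map_eq_one_iff φ' φ'.injective).2 (map_one φ.symm)
  have hv1 : v = 1 := by
    obtain ⟨l, hl⟩ := hP' v.2.2
    ext1
    · refine eq_one_of_pow_eq_one_of_coprime (m := 3 ^ k) (l := 4) ?_ ?_ ?_
      · exact congrArg Prod.fst h1
      · generalize v.1 = q
        revert q; decide
      · exact Nat.Coprime.pow_left k (by decide)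
    · ext1
      · refine eq_one_of_pow_eq_one_of_coprime (m := 3 ^ k) ?_ (hE' _) ?_
        · exact congrArg (fun u ↦ u.2.1) h1
        · exact Nat.Coprime.pow_left k (by decide)
      · refine eq_one_of_pow_eq_one_of_coprime (m := 3 ^ k) ?_ hl ?_
        · exact congrArg (fun u ↦ u.2.2) h1
        · exact Nat.Coprime.pow _ _ (by decide)
  rw [hv, map_eq_one_iff φ' φ'.injective, map_eq_one_iff φ.symm φ.symm.injective] at hv1
  exact congrArg (fun u ↦ u.2.2) hv1

theorem HasQuaternionPSplitting.of_subsingleton {G : Type*} [Group G] {σ : G →* ℤˣ} {x y : G}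
    {E P : Type*} [Group E] [Group P] [Subsingleton P] {p : ℕ}
    (h : HasQuaternionPSplitting p σ x y E P) : HasQuaternionSplitting σ x y E := by
  obtain ⟨hE, -, -, ⟨ψ⟩, g, hg, hgx, hgy, hg2, ⟨φ⟩⟩ := h
  let _ : Unique P := ⟨⟨1⟩, fun _ ↦ Subsingleton.elim _ _⟩
  exact ⟨hE, ⟨ψ.trans ((MulEquiv.refl _).prodCongr MulEquiv.prodUnique)⟩, g, hg, hgx, hgy, hg2,
    ⟨φ.trans ((MulEquiv.refl _).prodCongr MulEquiv.prodUnique)⟩⟩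

theorem HasQuaternionSplitting.upperLiePower_two_eq_bot {F : Type*} [Field F] (h2 : (2 : F) ≠ 0)
    {G : Type*} [Group G] {σ : G →* ℤˣ} {x y : G}
    (hxy : Nonempty (Subgroup.closure {x, y} ≃* QuaternionGroup 2)) {E : Type*} [Group E]
    (h : HasQuaternionSplitting σ x y E) : upperLiePower (symmetricElements F σ) 2 = ⊥ := by
  obtain ⟨hE, ⟨ψ⟩, g, hg, hgx, hgy, hg2, ⟨φ⟩⟩ := h
  have := upperLiePower_eq_bot_of_splitting h2 hxy (P := PUnit.{1}) hE (by simp)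
    (ψ.trans ((MulEquiv.refl _).prodCongr MulEquiv.prodUnique.symm)) hg hgx hgy hg2
    (φ.trans ((MulEquiv.refl _).prodCongr MulEquiv.prodUnique.symm)) (Or.inl inferInstance)
  simpa using this

theorem HasQuaternionPSplitting.upperLiePower_eq_bot {F : Type*} [Field F] (p : ℕ)
    [hp : Fact p.Prime] [CharP F p] (hp2 : p ≠ 2) {G : Type*} [Group G] {σ : G →* ℤˣ} {x y : G}
    (hxy : Nonempty (Subgroup.closure {x, y} ≃* QuaternionGroup 2)) {E P : Type*} [Group E]
    [Group P] (h : HasQuaternionPSplitting p σ x y E P) :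
    upperLiePower (symmetricElements F σ) (2 * Nat.card P) = ⊥ := by
  obtain ⟨hE, hfin, hP, ⟨ψ⟩, g, hg, hgx, hgy, hg2, ⟨φ⟩⟩ := h
  have hodd : Odd (Nat.card P) := by
    obtain ⟨n, hn⟩ := IsPGroup.iff_card.1 hP
    rw [hn]
    exact (hp.out.odd_of_ne_two hp2).pow
  have := upperLiePower_eq_bot_of_splitting (F := F)
    (Ring.two_ne_zero (by rwa [ringChar.eq F p])) hxy hE hodd ψ hg hgx hgy hg2 φ
    (Or.inr ⟨p, hp.out, inferInstance, hP⟩)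
  have hpos : 0 < Nat.card P := Nat.card_pos
  exact eq_bot_iff.2 (this ▸ upperLiePower_antitone _ (by omega))

theorem theorem2p2 {F : Type*} [Field F] (p : ℕ) [CharP F p] (hp : p ≠ 2)
    {G : Type u} [Group G] (σ : G →* ℤˣ) (hσ : σ ≠ 1) (x y : G)
    (hxy : Nonempty (Subgroup.closure {x, y} ≃* QuaternionGroup 2)) :
    (IsStronglyLieNilpotent (symmetricElements F σ) ↔
      ((p = 0 ∧ ∃ (E : Type u) (_ : Group E), HasQuaternionSplitting σ x y E) ∨
       (2 < p ∧ ∃ (E P : Type u) (_ : Group E) (_ : Group P),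
          HasQuaternionPSplitting p σ x y E P))) ∧
    (p = 0 → ∀ (E : Type u) [Group E], HasQuaternionSplitting σ x y E →
      upperLiePower (symmetricElements F σ) 2 = ⊥) ∧
    (2 < p → ∀ (E P : Type u) [Group E] [Group P], HasQuaternionPSplitting p σ x y E P →
      upperLiePower (symmetricElements F σ) (2 * Nat.card P) = ⊥) := by
  have h2 : (2 : F) ≠ 0 := Ring.two_ne_zero (by rwa [ringChar.eq F p])
  have hprime (h : 2 < p) : Fact p.Prime :=
    ⟨(CharP.char_is_prime_or_zero F p).resolve_right (by omega)⟩
  have hzero (E : Type u) [Group E] (h : HasQuaternionSplitting σ x y E) :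
      upperLiePower (symmetricElements F σ) 2 = ⊥ := h.upperLiePower_two_eq_bot h2 hxy
  have hpos (hp2 : 2 < p) (E P : Type u) [Group E] [Group P]
      (h : HasQuaternionPSplitting p σ x y E P) :
      upperLiePower (symmetricElements F σ) (2 * Nat.card P) = ⊥ :=
    have := hprime hp2
    h.upperLiePower_eq_bot p hp hxy
  refine ⟨⟨fun h ↦ ?_, ?_⟩, fun _ E _ ↦ hzero E, fun hp2 E P _ _ ↦ hpos hp2 E P⟩
  · rcases Nat.eq_zero_or_pos p with rfl | hp0
    · left
      have : CharZero F := CharP.charP_to_charZero F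
      have : Fact (Nat.Prime 3) := ⟨Nat.prime_three⟩
      have : Fact (Nat.Prime 5) := ⟨Nat.prime_five⟩
      obtain ⟨E, P, _, _, h3⟩ := exists_splitting_of_isStronglyLieNilpotent 3 (by decide) hσ hxy
        (h.of_charZero σ (K := ZMod 3)
          (Ring.two_ne_zero (by rw [ZMod.ringChar_zmod_n]; decide)))
      obtain ⟨E', P', _, _, h5⟩ := exists_splitting_of_isStronglyLieNilpotent 5 (by decide) hσ hxy
        (h.of_charZero σ (K := ZMod 5)
          (Ring.two_ne_zero (by rw [ZMod.ringChar_zmod_n]; decide)))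
      obtain ⟨-, -, hP, ⟨ψ⟩, -⟩ := id h3
      obtain ⟨hE', -, hP', ⟨ψ'⟩, -⟩ := h5
      have := subsingleton_of_splitting_three_five hP hE' hP' ψ ψ'
      exact ⟨rfl, E, inferInstance, h3.of_subsingleton⟩
    · right
      have hpp := (CharP.char_is_prime_or_zero F p).resolve_right hp0.ne'
      have : Fact p.Prime := ⟨hpp⟩
      have := hpp.two_le
      exact ⟨by omega, exists_splitting_of_isStronglyLieNilpotent p hp hσ hxy h⟩
  · rintro (⟨-, E, _, h⟩ | ⟨hp2, E, P, _, _, h⟩)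
    · exact ⟨2, by decide, hzero E h⟩
    · have hfin : Finite P := h.2.1
      have : 0 < Nat.card P := Nat.card_pos
      exact ⟨2 * Nat.card P, by omega, hpos hp2 E P h⟩

end Main
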